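/- Let $Z$ be a Dedekind domain that is not a field, let $Q$ be its field of fractions and let $K\neq 0$ be an étale $Q$-algebra. An order in $K$ is a subring of $K$ that is finitely generated as a $Z$-module and spans $K$ over $Q$. Let $S$ be an order in $K$. A fractional $S$-ideal is a finitely generated $S$-submodule of $K$ that is finitely generated over $Z$ and spans $K$ over $Q$; its multiplicator ring is $(I:I)=\{x\in K : xI\subseteq I\}$, and $I$ is invertible if $I\cdot\{x\in K : xI\subseteq S\}=S$. The primes of $S$ are its maximal ideals. For a prime $\mathfrak p$ of $S$, the local type of $S$ at $\mathfrak p$ is $$\mathrm{type}_{\mathfrak p}(S)=\dim_{S/\mathfrak p} S^t/\mathfrak p S^t,\qquad S^t=\{x\in K : \mathrm{Tr}_{K/Q}(xS)\subseteq Z\},$$ and $\mathrm{type}(S)$ is the maximum of the $\mathrm{type}_{\mathfrak p}(S)$ over all primes $\mathfrak p$ of $S$. Two fractional $S$-ideals $I,J$ are isomorphic if $I\simeq J$ as $S$-modules, and weakly equivalent if $I_{\mathfrak p}\simeq J_{\mathfrak p}$ as $S_{\mathfrak p}$-modules for every prime $\mathfrak p$ of $S$. For an order $T\supseteq S$, let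 $\mathrm{ICM}_T(S)$ and $\mathcal W_T(S)$ be the sets of isomorphism classes, respectively weak equivalence classes, of fractional $S$-ideals with multiplicator ring $T$, and let $\mathrm{Pic}(T)$ be the set (group) of isomorphism classes of invertible fractional $T$-ideals. Let $S\subseteq T$ be orders in $K$ with $\mathrm{type}(T)=2$. Then the number $N$ of primes $\mathfrak p$ of $T$ with $\mathrm{type}_{\mathfrak p}(T)=2$ is finite, and $$|\mathcal W_T(S)|=2^N,\qquad |\mathrm{ICM}_T(S)|=2^N\cdot|\mathrm{Pic}(T)|,$$ where the last equality is one of cardinal numbers, as $\mathrm{Pic}(T)$ may be infinite. -/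

import Mathlib

namespace EtaleOrder

variable {Z K : Type*} [CommRing Z] [CommRing K] [Algebra Z K]

/-- A `Z`-order in the `Q`-algebra `K`: a subring of `K` (automatically a `Z`-subalgebra) that is a
`Z`-lattice in `K`, i.e. it is finitely generated over `Z` and spans `K` over `Q`. -/
def IsOrder (Q : Type*) [Field Q] [Algebra Z Q] [Algebra Q K] [IsScalarTower Z Q K]
    (S : Subalgebra Z K) : Prop :=
  Submodule.IsLattice Q (Subalgebra.toSubmodule S)

/-- A fractional `S`-ideal: a finitely generated `S`-submodule of `K` that is a `Z`-lattice. -/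
def IsFracIdeal (Q : Type*) [Field Q] [Algebra Z Q] [Algebra Q K] [IsScalarTower Z Q K]
    {S : Subalgebra Z K} (I : Submodule S K) : Prop :=
  I.FG ∧ Submodule.IsLattice Q (I.restrictScalars Z)

/-- The type of fractional `S`-ideals. -/
def FracIdeal (Q : Type*) [Field Q] [Algebra Z Q] [Algebra Q K] [IsScalarTower Z Q K]
    (S : Subalgebra Z K) : Type _ :=
  {I : Submodule S K // IsFracIdeal Q I}

/-- The multiplicator ring `(I : I) = {x ∈ K | x I ⊆ I}`. -/
def multiplicatorRing {S : Subalgebra Z K} (I : Submodule S K) : Subalgebra Z K where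
  carrier := {x | ∀ y ∈ I, x * y ∈ I}
  mul_mem' {a b} ha hb y hy := by
    rw [mul_assoc]
    exact ha _ (hb _ hy)
  add_mem' {a b} ha hb y hy := by
    rw [add_mul]
    exact I.add_mem (ha _ hy) (hb _ hy)
  algebraMap_mem' r y hy := I.smul_mem (algebraMap Z S r) hy

/-- `I` is invertible over `S`: `I (S : I) = S`. Here `1` is `S` as a submodule of `K` and
`1 / I = {x ∈ K | x I ⊆ S}`. -/
def IsInvertible {S : Subalgebra Z K} (I : Submodule S K) : Prop :=
  I * (1 / I) = 1

/-- The trace dual `S^t = {x ∈ K | Tr(x S) ⊆ Z}`, as an `S`-submodule of `K`. -/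
noncomputable def traceDual (Q : Type*) [Field Q] [Algebra Z Q] [Algebra Q K]
    (S : Subalgebra Z K) : Submodule S K where
  carrier := {x | ∀ y ∈ S, Algebra.trace Q K (x * y) ∈ (algebraMap Z Q).range}
  zero_mem' y _ := by
    rw [zero_mul, map_zero]
    exact zero_mem _
  add_mem' {a b} ha hb y hy := by
    rw [add_mul, map_add]
    exact add_mem (ha _ hy) (hb _ hy)
  smul_mem' s x hx y hy := by
    have h : (s • x) * y = x * ((s : K) * y) := by
      rw [Algebra.smul_def, mul_comm x, mul_right_comm]
      rfl
    rw [h]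
    exact hx _ (S.mul_mem s.2 hy)

/-- The local type `dim_{S/p} (S^t / p S^t)` of `S` at a prime `p` (a maximal ideal of `S`). -/
noncomputable def typeAt (Q : Type*) [Field Q] [Algebra Z Q] [Algebra Q K]
    (S : Subalgebra Z K) (p : MaximalSpectrum S) : ℕ :=
  Module.finrank (S ⧸ p.asIdeal)
    (traceDual Q S ⧸ (p.asIdeal • ⊤ : Submodule S (traceDual Q S)))

/-- The type of `S`: the supremum, in `ℕ∞`, of the local types of `S` at its primes. -/
noncomputable def cmType (Q : Type*) [Field Q] [Algebra Z Q] [Algebra Q K]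
    (S : Subalgebra Z K) : ℕ∞ :=
  ⨆ p : MaximalSpectrum S, (typeAt Q S p : ℕ∞)

section Classes

variable (Q : Type*) [Field Q] [Algebra Z Q] [Algebra Q K] [IsScalarTower Z Q K]
  (S : Subalgebra Z K)

/-- Two fractional `S`-ideals are isomorphic if they are so as `S`-modules. -/
def isoSetoid : Setoid (FracIdeal Q S) where
  r I J := Nonempty (I.1 ≃ₗ[S] J.1)
  iseqv :=
    { refl := fun I => ⟨LinearEquiv.refl S I.1⟩
      symm := fun ⟨e⟩ => ⟨e.symm⟩
      trans := fun ⟨e⟩ ⟨f⟩ => ⟨e.trans f⟩ }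

/-- Two fractional `S`-ideals `I`, `J` are weakly equivalent if the localizations `I_p` and `J_p`
are isomorphic `S_p`-modules for every prime `p` of `S`. -/
def weakSetoid : Setoid (FracIdeal Q S) where
  r I J := ∀ (p : Ideal S) [p.IsMaximal],
    Nonempty (LocalizedModule p.primeCompl I.1 ≃ₗ[Localization.AtPrime p]
      LocalizedModule p.primeCompl J.1)
  iseqv :=
    { refl := fun _ _ _ => ⟨LinearEquiv.refl _ _⟩
      symm := fun h p _ => (h p).map LinearEquiv.symm
      trans := fun h h' p _ => (h p).elim fun e => (h' p).map fun f => e.trans f }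

/-- The set of isomorphism classes of fractional `S`-ideals. -/
def ICM : Type _ := Quotient (isoSetoid Q S)

/-- The set of weak equivalence classes of fractional `S`-ideals. -/
def WeakClasses : Type _ := Quotient (weakSetoid Q S)

/-- The isomorphism classes of fractional `S`-ideals with multiplicator ring `T`. -/
def icmWith (T : Subalgebra Z K) : Set (ICM Q S) :=
  {c | ∃ I : FracIdeal Q S, multiplicatorRing I.1 = T ∧ Quotient.mk (isoSetoid Q S) I = c}

/-- The weak equivalence classes of fractional `S`-ideals with multiplicator ring `T`. -/
def weakClassesWith (T : Subalgebra Z K) : Set (WeakClasses Q S) :=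
  {c | ∃ I : FracIdeal Q S, multiplicatorRing I.1 = T ∧ Quotient.mk (weakSetoid Q S) I = c}

/-- The Picard group of `S`, as a set: the isomorphism classes of invertible fractional
`S`-ideals. -/
def pic : Set (ICM Q S) :=
  {c | ∃ I : FracIdeal Q S, IsInvertible I.1 ∧ Quotient.mk (isoSetoid Q S) I = c}

end Classes

end EtaleOrder

/-!
Fractional `S`-ideals with multiplicator ring `T` are the fractional `T`-ideals `I` with
`(I : I) = T`. Write `I^t` for the trace dual; it is a fractional ideal with `I^tt = I`, because a
lattice over a Dedekind domain is projective and so has a dual basis for the trace form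
(`exists_trace_dual_basis`). It follows that `I I^t` is the dual of `(I : I) = T`, that is,
`I I^t = T^t` (`mul_dual_eq`).

Let `P` be a prime of `T` of type at most `2`. Multiplication `I × I^t → T^t / P T^t` is a bilinear
map whose values span a space of dimension at most `2`. Elementary linear algebra
(`exists_surjective_of_finrank_le_two`) gives a single `x ∈ I` with `x I^t` mapping onto this space,
or a single `y ∈ I^t` with `y I` mapping onto it; since `Z` is infinite, `x` or `y` can be taken to
be a unit of `K`. By Nakayama's lemma `x I^t = T^t` or `y I = T^t` locally at `P`; dualizing the
former, `I` is locally isomorphic to `T` or to `T^t` (`locEq_one_or_locEq_dual`). These two modules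
are locally isomorphic exactly where the type is at most `1`. Hence the set of primes of type `2` at
which `I` is not locally principal determines the weak equivalence class of `I`. Every set of primes
of type `2` occurs, by gluing `T^t` and `T` (`exists_locEq_of_set`), and there are only finitely
many such primes. This gives `2 ^ N` weak equivalence classes.

Finally, if `I` and `J` are weakly equivalent then `L = (J : I)` is invertible and `J = L I`; and
`L I ≃ L' I` forces `L ≃ L'` since `(L I : I) = L`. So the isomorphism classes in each weak
equivalence class correspond to `Pic(T)`.

An isomorphism `I_P ≃ J_P` is encoded by `a ∈ (J : I)` and `b ∈ (I : J)` with `a b ∈ T \ P`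
(`LocEq`), so that these arguments take place inside `K`. This agrees with isomorphism of localized
modules, as linear maps between fractional ideals are multiplications by elements of `K`
(`nonempty_localized_linearEquiv_of_locEq`, `locEq_of_localized_linearEquiv`), and may be tested at
the primes of `S` or at those of `T` (`forall_locEq_restrictTo_iff`).
-/

namespace EtaleOrder

/-! ### The trace form of an étale algebra -/

section Trace

variable {Q K : Type*} [Field Q] [CommRing K] [Algebra Q K]

theorem trace_pi_single {ι : Type*} [Finite ι] [DecidableEq ι] (A : ι → Type*)
    [∀ i, CommRing (A i)] [∀ i, Algebra Q (A i)]
    [∀ i, Module.Finite Q (A i)] (i : ι) (a : A i) :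
    Algebra.trace Q (∀ i, A i) (Pi.single i a) = Algebra.trace Q (A i) a := by
  have e1 : Algebra.lmul Q (∀ i, A i) (Pi.single i a) =
      (LinearMap.single Q A i) ∘ₗ (Algebra.lmul Q (A i) a ∘ₗ LinearMap.proj i) := by
    ext j b k
    by_cases hk : k = i
    · subst hk; simp
    · simp [hk]
  rw [Algebra.trace_apply, Algebra.trace_apply, e1]
  rw [LinearMap.trace_comp_comm']
  congr 1
  ext b
  simp

/-- The trace form of an étale algebra over a field is nondegenerate: the algebra is a finite
product of finite separable field extensions. -/
theorem traceForm_nondegenerate_of_etale [Algebra.Etale Q K] :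
    (Algebra.traceForm Q K).Nondegenerate := by
  classical
  obtain ⟨ι, _, A, _, _, e, h⟩ := (Algebra.Etale.iff_exists_algEquiv_prod Q K).mp inferInstance
  have := fun i => (h i).1
  have := fun i => (h i).2
  have key : ∀ x : K, (∀ y, Algebra.trace Q K (x * y) = 0) → x = 0 := by
    intro x hx
    apply e.injective
    rw [map_zero]
    funext i
    refine (traceForm_nondegenerate Q (A i)).1 (e x i) fun b => ?_
    have := hx (e.symm (Pi.single i b))
    rw [← Algebra.trace_eq_of_algEquiv e, map_mul, e.apply_symm_apply] at this
    rw [Algebra.traceForm_apply, ← trace_pi_single A i, ← this]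
    congr 1
    ext k
    by_cases hk : k = i
    · subst hk; simp
    · simp [hk]
  exact ⟨fun x hx => key x fun y => hx y, fun x hx => key x fun y => by
    rw [mul_comm]; exact hx y⟩

end Trace

/-! ### Lattices -/

section Lattice

variable {Z Q K : Type*} [CommRing Z] [Field Q] [Algebra Z Q] [IsFractionRing Z Q]
  [CommRing K] [Algebra Q K] [Algebra Z K] [IsScalarTower Z Q K]

theorem exists_smul_mem_of_isLattice [IsDomain Z] (N : Submodule Z K)
    (hN : Submodule.IsLattice Q N) (x : K) :
    ∃ z : Z, z ≠ 0 ∧ z • x ∈ N := by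
  have hx : x ∈ Submodule.span Q (N : Set K) := by rw [hN.span_eq_top]; trivial
  induction hx using Submodule.span_induction with
  | mem x h => exact ⟨1, one_ne_zero, by simpa using h⟩
  | zero => exact ⟨1, one_ne_zero, by simp⟩
  | add x y _ _ hx hy =>
    obtain ⟨a, ha, hx⟩ := hx
    obtain ⟨b, hb, hy⟩ := hy
    refine ⟨a * b, mul_ne_zero ha hb, ?_⟩
    rw [smul_add]
    refine N.add_mem ?_ ?_
    · rw [mul_comm, mul_smul]; exact N.smul_mem _ hx
    · rw [mul_smul]; exact N.smul_mem _ hy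
  | smul q x _ hx =>
    obtain ⟨a, ha, hx⟩ := hx
    obtain ⟨n, d, hd, rfl⟩ := IsFractionRing.div_surjective (A := Z) q
    have hd0 : algebraMap Z Q d ≠ 0 := by
      simpa using nonZeroDivisors.ne_zero hd
    refine ⟨d * a, mul_ne_zero (nonZeroDivisors.ne_zero hd) ha, ?_⟩
    have : (d * a) • (algebraMap Z Q n / algebraMap Z Q d) • x = n • (a • x) := by
      rw [← algebraMap_smul Q (d * a), ← algebraMap_smul Q n, ← algebraMap_smul Q a, smul_smul,
        smul_smul, map_mul]
      congr 1
      field_simp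
    rw [this]
    exact N.smul_mem _ hx

theorem isLattice_of_exists_smul_mem (N : Submodule Z K) (hfg : N.FG)
    (h : ∀ x : K, ∃ z : Z, z ≠ 0 ∧ z • x ∈ N) : Submodule.IsLattice Q N := by
  refine ⟨hfg, eq_top_iff.mpr fun x _ => ?_⟩
  obtain ⟨z, hz, hx⟩ := h x
  have hz0 : algebraMap Z Q z ≠ 0 := by simpa using hz
  have : x = (algebraMap Z Q z)⁻¹ • (z • x) := by
    rw [← algebraMap_smul Q z, smul_smul, inv_mul_cancel₀ hz0, one_smul]
  rw [this]
  exact Submodule.smul_mem _ _ (Submodule.subset_span hx)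

/-- A `Z`-linear form on a lattice extends to a `Q`-linear form on the ambient space. -/
theorem exists_extend_of_isLattice [IsDomain Z] (N : Submodule Z K) (hN : Submodule.IsLattice Q N)
    (f : N →ₗ[Z] Z) :
    ∃ g : K →ₗ[Q] Q, ∀ x : N, g x = algebraMap Z Q (f x) := by
  have hloc : IsLocalizedModule (nonZeroDivisors Z) N.subtype := by
    refine ⟨fun z => ?_, fun x => ?_, fun {x y} h => ?_⟩
    · have hz0 : algebraMap Z Q z ≠ 0 := by simp
      rw [Module.End.isUnit_iff]
      constructor
      · intro x y hxy
        simp only [Module.algebraMap_end_apply] at hxy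
        rw [← algebraMap_smul Q (z : Z) x, ← algebraMap_smul Q (z : Z) y] at hxy
        rw [← inv_smul_smul₀ hz0 x, hxy, inv_smul_smul₀ hz0]
      · intro x
        refine ⟨(algebraMap Z Q z)⁻¹ • x, ?_⟩
        simp only [Module.algebraMap_end_apply]
        rw [← algebraMap_smul Q (z : Z), smul_smul, mul_inv_cancel₀ hz0, one_smul]
    · obtain ⟨z, hz, hx⟩ := exists_smul_mem_of_isLattice N hN x
      exact ⟨⟨⟨_, hx⟩, ⟨z, mem_nonZeroDivisors_of_ne_zero hz⟩⟩, rfl⟩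
    · exact ⟨1, by simpa using h⟩
  let g0 := IsLocalizedModule.mapExtendScalars (nonZeroDivisors Z) N.subtype
    (Algebra.linearMap Z Q) Q f
  refine ⟨g0, fun x => ?_⟩
  have := IsLocalizedModule.map_apply (nonZeroDivisors Z) N.subtype
    (Algebra.linearMap Z Q) f x
  simpa [g0] using this

end Lattice

/-! ### Dual bases -/

section Dual

variable {Z Q K : Type*} [CommRing Z] [IsDedekindDomain Z] [Field Q] [Algebra Z Q]
  [IsFractionRing Z Q] [CommRing K] [Algebra Q K] [Algebra.Etale Q K] [Algebra Z K]
  [IsScalarTower Z Q K]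

/-- A lattice `N` over a Dedekind domain has a dual basis with respect to the trace form:
finitely many `e i ∈ N` and `e' i` in the trace dual of `N` with `x = ∑ Tr(e' i * x) e i` for all
`x`. Since `N` is projective but in general not free, these are only generating systems. -/
theorem exists_trace_dual_basis (N : Submodule Z K) (hN : Submodule.IsLattice Q N) :
    ∃ (n : ℕ) (e e' : Fin n → K), (∀ i, e i ∈ N) ∧
      (∀ i, ∀ x ∈ N, Algebra.trace Q K (e' i * x) ∈ (algebraMap Z Q).range) ∧
      ∀ x, x = ∑ i, Algebra.trace Q K (e' i * x) • e i := by
  have : Module.Finite Z N := Module.Finite.iff_fg.mpr hN.fg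
  have : Module.Finite Q K := Algebra.FormallyUnramified.finite_of_free Q K
  have : Module.IsTorsionFree Z Q := inferInstance
  have : Module.IsTorsionFree Z K := .trans_faithfulSMul Z Q K
  have := Module.finitePresentation_of_finite Z N
  have : Module.Projective Z N := Module.Flat.projective_of_finitePresentation
  obtain ⟨n, f, hf⟩ := Module.Finite.exists_fin' Z N
  obtain ⟨s, hs⟩ := LinearMap.exists_rightInverse_of_surjective f (LinearMap.range_eq_top.mpr hf)
  choose g hg using fun i : Fin n => exists_extend_of_isLattice N hN (LinearMap.proj i ∘ₗ s)
  have hB := traceForm_nondegenerate_of_etale (Q := Q) (K := K)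
  let e' : Fin n → K := fun i => ((Algebra.traceForm Q K).toDual hB).symm (g i)
  have he' : ∀ i x, Algebra.trace Q K (e' i * x) = g i x := fun i x => by
    rw [← Algebra.traceForm_apply]
    exact LinearMap.BilinForm.apply_toDual_symm_apply (hB := hB) (g i) x
  have hN1 : ∀ x ∈ N, x = ∑ i, g i x • (f (Pi.single i 1) : K) := by
    intro x hx
    have h1 : f (s ⟨x, hx⟩) = ⟨x, hx⟩ := LinearMap.congr_fun hs ⟨x, hx⟩
    rw [LinearMap.pi_apply_eq_sum_univ f] at h1
    have h2 := congrArg (N.subtype) h1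
    simp only [map_sum, map_smul, Submodule.subtype_apply] at h2
    conv_lhs => rw [← h2]
    refine Finset.sum_congr rfl fun i _ => ?_
    have := hg i ⟨x, hx⟩
    simp only [LinearMap.comp_apply, LinearMap.proj_apply] at this
    rw [this, algebraMap_smul]
    congr 4
    ext j
    simp [Pi.single_apply, eq_comm]
  refine ⟨n, fun i => f (Pi.single i 1), e', fun i => (f _).2, fun i x hx => ?_, fun x => ?_⟩
  · rw [he', hg i ⟨x, hx⟩]
    exact ⟨_, rfl⟩
  · simp only [he']
    have hx : x ∈ Submodule.span Q (N : Set K) := by rw [hN.span_eq_top]; trivial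
    induction hx using Submodule.span_induction with
    | mem x h => exact hN1 x h
    | zero => simp
    | add x y _ _ hx hy =>
      conv_lhs => rw [hx, hy]
      simp [add_smul, Finset.sum_add_distrib]
    | smul q x _ hx =>
      conv_lhs => rw [hx]
      simp [Finset.smul_sum, smul_smul]

end Dual

/-! ### Fractional ideals -/

section FracIdeal

variable {Z Q K : Type*} [CommRing Z] [IsDedekindDomain Z] [Field Q] [Algebra Z Q]
  [IsFractionRing Z Q] [CommRing K] [Algebra Q K] [Algebra Z K]
  [IsScalarTower Z Q K] {T : Subalgebra Z K}

omit [IsDedekindDomain Z] [Field Q] [Algebra Z Q] [IsFractionRing Z Q] [CommRing K] [Algebra Q K]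
  [Algebra Z K] [IsScalarTower Z Q K] in
theorem isUnit_algebraMap (Q K : Type*) [Field Q] [Algebra Z Q] [IsFractionRing Z Q] [CommRing K]
    [Algebra Q K] [Algebra Z K] [IsScalarTower Z Q K] {c : Z} (hc : c ≠ 0) :
    IsUnit (algebraMap Z K c) := by
  rw [IsScalarTower.algebraMap_apply Z Q K]
  exact (IsUnit.mk0 _ (by simpa using hc)).map _

omit [IsDedekindDomain Z] [IsFractionRing Z Q] in
theorem IsOrder.moduleFinite (hT : IsOrder Q T) : Module.Finite Z T :=
  Module.Finite.iff_fg.mpr hT.fg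

omit [IsFractionRing Z Q] in
theorem IsOrder.isNoetherianRing (hT : IsOrder Q T) : IsNoetherianRing T :=
  have := hT.moduleFinite
  IsNoetherianRing.of_finite Z T

theorem IsFracIdeal.exists_smul_mem {I : Submodule T K} (hI : IsFracIdeal Q I) (x : K) :
    ∃ z : Z, z ≠ 0 ∧ z • x ∈ I :=
  exists_smul_mem_of_isLattice _ hI.2 x

omit [IsDedekindDomain Z] in
theorem isFracIdeal_of_fg (hT : IsOrder Q T) {I : Submodule T K} (h1 : I.FG)
    (h2 : ∀ x : K, ∃ z : Z, z ≠ 0 ∧ z • x ∈ I) : IsFracIdeal Q I := by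
  refine ⟨h1, isLattice_of_exists_smul_mem _ ?_ h2⟩
  have := hT.moduleFinite
  have : Module.Finite T I := Module.Finite.iff_fg.mpr h1
  have : Module.Finite Z I := Module.Finite.trans T I
  have : Module.Finite Z (I.restrictScalars Z) := this
  exact Module.Finite.iff_fg.mp this

theorem IsFracIdeal.of_le_of_smul_mem (hT : IsOrder Q T) {I J : Submodule T K}
    (hJ : IsFracIdeal Q J) (h1 : I ≤ J)
    (h2 : ∀ x : K, ∃ z : Z, z ≠ 0 ∧ z • x ∈ I) : IsFracIdeal Q I := by
  have := hT.isNoetherianRing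
  have : IsNoetherian T J := isNoetherian_of_fg_of_noetherian _ hJ.1
  exact isFracIdeal_of_fg hT (Submodule.FG.of_le hJ.1 h1) h2

theorem isFracIdeal_one (hT : IsOrder Q T) : IsFracIdeal Q (1 : Submodule T K) := by
  refine isFracIdeal_of_fg hT ?_ fun x => ?_
  · rw [Submodule.one_eq_span]; exact Submodule.fg_span_singleton 1
  · obtain ⟨z, hz, hx⟩ := exists_smul_mem_of_isLattice _ hT x
    exact ⟨z, hz, Submodule.mem_one.mpr ⟨⟨_, hx⟩, rfl⟩⟩

theorem IsFracIdeal.mul (hT : IsOrder Q T) {I J : Submodule T K} (hI : IsFracIdeal Q I)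
    (hJ : IsFracIdeal Q J) : IsFracIdeal Q (I * J) := by
  refine isFracIdeal_of_fg hT (hI.1.mul hJ.1) fun x => ?_
  obtain ⟨a, ha, hx⟩ := hI.exists_smul_mem x
  obtain ⟨b, hb, h1⟩ := hJ.exists_smul_mem 1
  refine ⟨a * b, mul_ne_zero ha hb, ?_⟩
  have : (a * b) • x = (a • x) * (b • (1 : K)) := by
    rw [smul_mul_smul_comm, mul_one]
  rw [this]
  exact Submodule.mul_mem_mul hx h1

end FracIdeal

/-! ### Trace duals -/

section Dual

variable {Z Q K : Type*} [CommRing Z] [Field Q] [Algebra Z Q]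
  [CommRing K] [Algebra Q K] [Algebra Z K] {T : Subalgebra Z K}

variable (Q) in
/-- The trace dual `{x ∈ K | Tr(x I) ⊆ Z}` of a `T`-submodule `I` of `K`, again as a
`T`-submodule. -/
noncomputable def dual (I : Submodule T K) : Submodule T K where
  carrier := {x | ∀ y ∈ I, Algebra.trace Q K (x * y) ∈ (algebraMap Z Q).range}
  zero_mem' y _ := by
    rw [zero_mul, map_zero]
    exact zero_mem _
  add_mem' {a b} ha hb y hy := by
    rw [add_mul, map_add]
    exact add_mem (ha _ hy) (hb _ hy)
  smul_mem' s x hx y hy := by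
    rw [smul_mul_assoc, ← mul_smul_comm]
    exact hx _ (I.smul_mem s hy)

theorem dual_one : dual Q (1 : Submodule T K) = traceDual Q T := by
  ext x
  refine ⟨fun h y hy => h y (Submodule.mem_one.mpr ⟨⟨y, hy⟩, rfl⟩), fun h y hy => ?_⟩
  obtain ⟨t, rfl⟩ := Submodule.mem_one.mp hy
  exact h _ t.2

theorem dual_mul (I J : Submodule T K) : dual Q (I * J) = dual Q I / J := by
  ext x
  rw [Submodule.mem_div_iff_forall_mul_mem]
  constructor
  · intro h j hj i hi
    rw [mul_assoc, mul_comm j]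
    exact h _ (Submodule.mul_mem_mul hi hj)
  · intro h y hy
    induction hy using Submodule.mul_induction_on' with
    | mem_mul_mem i hi j hj =>
      rw [mul_comm i, ← mul_assoc]
      exact h j hj i hi
    | add a _ b _ ha hb =>
      rw [mul_add, map_add]
      exact add_mem ha hb

theorem le_dual_dual (I : Submodule T K) : I ≤ dual Q (dual Q I) := fun x hx y hy => by
  rw [mul_comm]
  exact hy x hx

variable [IsDedekindDomain Z] [IsFractionRing Z Q] [Algebra.Etale Q K] [IsScalarTower Z Q K]

theorem dual_dual {I : Submodule T K} (hI : IsFracIdeal Q I) : dual Q (dual Q I) = I := by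
  refine le_antisymm (fun x hx => ?_) (le_dual_dual I)
  obtain ⟨n, e, e', he, he', h⟩ := exists_trace_dual_basis _ hI.2
  rw [h x]
  refine I.sum_mem fun i _ => ?_
  obtain ⟨z, hz⟩ := hx (e' i) fun y hy => he' i y hy
  rw [mul_comm, ← hz, algebraMap_smul]
  exact (I.restrictScalars Z).smul_mem z (he i)

theorem IsFracIdeal.dual (hT : IsOrder Q T) {I : Submodule T K} (hI : IsFracIdeal Q I) :
    IsFracIdeal Q (dual Q I) := by
  obtain ⟨n, e, e', he, he', h⟩ := exists_trace_dual_basis _ hI.2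
  have hexp : ∀ x y : K, Algebra.trace Q K (x * y) =
      ∑ i, Algebra.trace Q K (e' i * y) * Algebra.trace Q K (x * e i) := by
    intro x y
    conv_lhs => rw [h y]
    simp [Finset.mul_sum]
  have hB := traceForm_nondegenerate_of_etale (Q := Q) (K := K)
  have hx : ∀ x : K, x = ∑ i, Algebra.trace Q K (x * e i) • e' i := by
    intro x
    rw [← sub_eq_zero]
    refine hB.1 _ fun y => ?_
    rw [Algebra.traceForm_apply, sub_mul, map_sub, hexp, Finset.sum_mul, map_sum, sub_eq_zero]
    refine Finset.sum_congr rfl fun i _ => ?_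
    rw [smul_mul_assoc, map_smul, smul_eq_mul, mul_comm]
  have hle : EtaleOrder.dual Q I ≤ Submodule.span T (Set.range e') := by
    intro x hxd
    rw [hx x]
    refine Submodule.sum_mem _ fun i _ => ?_
    obtain ⟨z, hz⟩ := hxd (e i) (he i)
    rw [← hz, algebraMap_smul, ← algebraMap_smul T z]
    exact Submodule.smul_mem _ _ (Submodule.subset_span ⟨i, rfl⟩)
  have := hT.isNoetherianRing
  have hfg : (Submodule.span T (Set.range e')).FG := Submodule.fg_span (Set.finite_range e')
  refine isFracIdeal_of_fg hT (Submodule.FG.of_le hfg hle) fun x => ?_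
  obtain ⟨b, hb⟩ := IsLocalization.exist_integer_multiples_of_finite (nonZeroDivisors Z)
    fun i => Algebra.trace Q K (x * e i)
  refine ⟨b, nonZeroDivisors.ne_zero b.2, fun y hy => ?_⟩
  rw [smul_mul_assoc, ← algebraMap_smul Q (b : Z), map_smul, hexp, Finset.smul_sum]
  refine sum_mem fun i _ => ?_
  rw [← mul_smul_comm]
  refine mul_mem (he' i y hy) ?_
  rw [algebraMap_smul]
  exact hb i

theorem div_eq_dual {I : Submodule T K} (hI : IsFracIdeal Q I) (J : Submodule T K) :
    I / J = dual Q (dual Q I * J) := by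
  rw [dual_mul, dual_dual hI]

theorem IsFracIdeal.div (hT : IsOrder Q T) {I J : Submodule T K} (hI : IsFracIdeal Q I)
    (hJ : IsFracIdeal Q J) : IsFracIdeal Q (I / J) := by
  rw [div_eq_dual hI]
  exact ((hI.dual hT).mul hT hJ).dual hT

/-- If `(I : I) = T` then `I` times its trace dual is the trace dual of `T`. -/
theorem mul_dual_eq (hT : IsOrder Q T) {I : Submodule T K} (hI : IsFracIdeal Q I)
    (h : I / I = 1) : I * dual Q I = dual Q 1 := by
  rw [← dual_dual (hI.mul hT (hI.dual hT)), mul_comm, ← div_eq_dual hI, h]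

theorem dual_one_div_dual_one (hT : IsOrder Q T) :
    dual Q (1 : Submodule T K) / dual Q 1 = 1 := by
  rw [← dual_mul, one_mul, dual_dual (isFracIdeal_one hT)]

end Dual

/-! ### Local isomorphism by multiplication -/

section LocEq

variable {Z K : Type*} [CommRing Z] [CommRing K] [Algebra Z K] {T : Subalgebra Z K}

theorem one_div_one : (1 : Submodule T K) / 1 = 1 := by
  refine le_antisymm (fun x hx => ?_) ?_
  · have := hx 1 (Submodule.one_le.mp le_rfl)
    rwa [mul_one] at this
  · rw [Submodule.le_div_iff_mul_le, mul_one]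

/-- `I` and `J` become isomorphic after localization at the prime `P` of `T`, by multiplication by
an element of `K`: there are `a ∈ (J : I)` and `b ∈ (I : J)` whose product is an element of `T`
outside `P`. -/
def LocEq (P : Ideal T) (I J : Submodule T K) : Prop :=
  ∃ a ∈ J / I, ∃ b ∈ I / J, ∃ s : T, s ∉ P ∧ a * b = s

theorem LocEq.symm {P : Ideal T} {I J : Submodule T K} (h : LocEq P I J) : LocEq P J I := by
  obtain ⟨a, ha, b, hb, s, hs, e⟩ := h
  exact ⟨b, hb, a, ha, s, hs, by rw [mul_comm, e]⟩

theorem div_mul_div_mem {I J L : Submodule T K} {a b : K} (ha : a ∈ L / J) (hb : b ∈ J / I) :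
    a * b ∈ L / I := fun x hx => by
  rw [mul_assoc]
  exact ha _ (hb _ hx)

theorem LocEq.trans {P : Ideal T} (hP : P.IsPrime) {I J L : Submodule T K} (h : LocEq P I J)
    (h' : LocEq P J L) : LocEq P I L := by
  obtain ⟨a, ha, b, hb, s, hs, e⟩ := h
  obtain ⟨c, hc, d, hd, t, ht, f⟩ := h'
  refine ⟨c * a, div_mul_div_mem hc ha, b * d, div_mul_div_mem hb hd, s * t,
    fun h => (hP.mem_or_mem h).elim hs ht, ?_⟩
  rw [show c * a * (b * d) = (a * b) * (c * d) by ring, e, f]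
  rfl

/-- A `T`-submodule of `K` containing, for every maximal ideal of `T`, an element of `T` outside of
it, contains `1`. -/
theorem one_mem_of_forall_maximal (N : Submodule T K)
    (h : ∀ P : MaximalSpectrum T, ∃ s : T, s ∉ P.asIdeal ∧ (s : K) ∈ N) : (1 : K) ∈ N := by
  by_contra h1
  have hne : N.comap (Algebra.linearMap T K) ≠ ⊤ := fun htop => by
    have : (1 : T) ∈ N.comap (Algebra.linearMap T K) := htop ▸ Submodule.mem_top
    exact h1 (by simpa using this)
  obtain ⟨P, hP, hle⟩ := Ideal.exists_le_maximal (N.comap (Algebra.linearMap T K)) hne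
  obtain ⟨s, hs, hsN⟩ := h ⟨P, hP⟩
  exact hs (hle hsN)

theorem exists_mul_notMem_of_mul_eq_one {L M : Submodule T K} (h : L * M = 1) (P : Ideal T)
    (hP : P ≠ ⊤) : ∃ l ∈ L, ∃ m ∈ M, ∃ s : T, s ∉ P ∧ l * m = s := by
  by_contra! hne
  have h1 : L * M ≤ Submodule.map (Algebra.linearMap T K) P := by
    rw [Submodule.mul_le]
    intro l hl m hm
    obtain ⟨s, hs⟩ := Submodule.mem_one.mp (h.le (Submodule.mul_mem_mul hl hm))
    refine ⟨s, ?_, hs⟩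
    by_contra hsP
    exact hne l hl m hm s hsP hs.symm
  obtain ⟨s, hs, hs1⟩ := h1 (h ▸ Submodule.one_le.mp le_rfl)
  have : s = 1 := Subtype.ext hs1
  exact hP ((Ideal.eq_top_iff_one _).mpr (this ▸ hs))

theorem div_mul_div_eq_one_iff {I J : Submodule T K} (hI : I / I = 1) :
    (J / I) * (I / J) = 1 ↔ ∀ P : MaximalSpectrum T, LocEq P.asIdeal I J := by
  have hle : (J / I) * (I / J) ≤ 1 := by
    rw [Submodule.mul_le, ← hI]
    intro a ha b hb
    rw [mul_comm]
    exact div_mul_div_mem hb ha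
  constructor
  · exact fun h P => exists_mul_notMem_of_mul_eq_one h P.asIdeal P.isMaximal.ne_top
  · intro h
    refine le_antisymm hle (Submodule.one_le.mpr (one_mem_of_forall_maximal _ fun P => ?_))
    obtain ⟨a, ha, b, hb, s, hs, e⟩ := h P
    exact ⟨s, hs, e ▸ Submodule.mul_mem_mul ha hb⟩

/-- A module that is at every prime isomorphic to one with multiplicator ring `T` has itself
multiplicator ring `T`. -/
theorem div_self_eq_one_of_locEq {I : Submodule T K}
    (h : ∀ P : MaximalSpectrum T, ∃ J : Submodule T K, J / J = 1 ∧ LocEq P.asIdeal J I) :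
    I / I = 1 := by
  refine le_antisymm (fun x hx => ?_) ?_
  · have key : (1 : K) ∈ (1 : Submodule T K) / Submodule.span T {x} := by
      refine one_mem_of_forall_maximal _ fun P => ?_
      obtain ⟨J, hJ, a, ha, b, hb, s, hs, e⟩ := h P
      refine ⟨s, hs, fun y hy => ?_⟩
      obtain ⟨t, rfl⟩ := Submodule.mem_span_singleton.mp hy
      rw [mul_smul_comm]
      refine Submodule.smul_mem _ _ ?_
      rw [← e, ← hJ, show a * b * x = b * (x * a) by ring]
      exact div_mul_div_mem hb (div_mul_div_mem hx ha)
    simpa using key x (Submodule.mem_span_singleton_self x)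
  · rw [Submodule.le_div_iff_mul_le, one_mul]

end LocEq

/-! ### Bilinear maps onto a plane -/

section LinearAlgebra

variable {R U A B : Type*} [CommRing R] [AddCommGroup U] [Module R U] [AddCommGroup A] [Module R A]
  [AddCommGroup B] [Module R B] (P : Ideal R) [Module (R ⧸ P) U]
  [IsScalarTower R (R ⧸ P) U]

theorem exists_smul_eq_quotient_smul (c : R ⧸ P) : ∃ r : R, ∀ u : U, c • u = r • u := by
  obtain ⟨r, rfl⟩ := Ideal.Quotient.mk_surjective c
  exact ⟨r, fun u => algebraMap_smul (R ⧸ P) r u⟩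

/-- In a vector space of dimension at most `2` over `R ⧸ P`, a submodule containing a nonzero
vector and one that is not a multiple of it is everything. -/
theorem eq_top_of_finrank_le_two [P.IsMaximal] [Module.Finite (R ⧸ P) U]
    (h2 : Module.finrank (R ⧸ P) U ≤ 2) {u v : U} (hu : u ≠ 0)
    (hv : v ∉ Submodule.span R {u}) (N : Submodule R U) (huN : u ∈ N) (hvN : v ∈ N) : N = ⊤ := by
  let := Ideal.Quotient.field P
  have hli : LinearIndependent (R ⧸ P) ![u, v] := by
    rw [LinearIndependent.pair_iff' hu]
    intro c hc
    obtain ⟨r, hr⟩ := exists_smul_eq_quotient_smul (U := U) P c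
    exact hv (Submodule.mem_span_singleton.mpr ⟨r, by rw [← hr, hc]⟩)
  have h2' : Fintype.card (Fin 2) = Module.finrank (R ⧸ P) U := by
    refine le_antisymm ?_ (by simpa using h2)
    exact hli.fintype_card_le_finrank
  have htop := hli.span_eq_top_of_card_eq_finrank' h2'
  refine eq_top_iff.mpr fun x _ => ?_
  have hx : x ∈ Submodule.span (R ⧸ P) (Set.range ![u, v]) := htop ▸ Submodule.mem_top
  rw [Matrix.range_cons, Matrix.range_cons, Matrix.range_empty, Set.union_empty] at hx
  obtain ⟨c, d, rfl⟩ := Submodule.mem_span_pair.mp hx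
  obtain ⟨r, hr⟩ := exists_smul_eq_quotient_smul (U := U) P c
  obtain ⟨s, hs⟩ := exists_smul_eq_quotient_smul (U := U) P d
  rw [hr, hs]
  exact N.add_mem (N.smul_mem _ huN) (N.smul_mem _ hvN)

/-- Let `β` be a bilinear map whose values span a vector space of dimension at most `2`. Then
`β x` is surjective for some `x`, or `β · y` is surjective for some `y`. If `u₁ = β x₁ y₁` and
`u₂ = β x₂ y₂` form a basis and none of `x₁`, `x₂`, `y₁`, `y₂` will do, then
`β x₁ y₂ = β x₂ y₁ = 0`, so that `x₁ + x₂` does. -/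
theorem exists_surjective_of_finrank_le_two [P.IsMaximal] [Module.Finite (R ⧸ P) U]
    (h2 : Module.finrank (R ⧸ P) U ≤ 2) (β : A →ₗ[R] B →ₗ[R] U)
    (hβ : Submodule.span R {u | ∃ x y, β x y = u} = ⊤) :
    (∃ x, LinearMap.range (β x) = ⊤) ∨ ∃ y, LinearMap.range (β.flip y) = ⊤ := by
  by_contra! hne
  obtain ⟨hA, hB⟩ := hne
  have key : ∀ N : Submodule R U, N ≠ ⊤ → ∀ u ∈ N, u ≠ 0 → ∀ v ∈ N, v ∈ Submodule.span R {u} :=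
    fun N hN u hu hu0 v hv => by
      by_contra hvu
      exact hN (eq_top_of_finrank_le_two P h2 hu0 hvu N hu hv)
  by_cases h0 : ∀ x y, β x y = 0
  · refine hA 0 (eq_top_iff.mpr ?_)
    rw [← hβ, Submodule.span_le]
    rintro _ ⟨x, y, rfl⟩
    rw [h0]
    exact Submodule.zero_mem _
  push Not at h0
  obtain ⟨x₁, y₁, h1⟩ := h0
  by_cases hs : ∀ x y, β x y ∈ Submodule.span R {β x₁ y₁}
  · refine hA x₁ (eq_top_iff.mpr ?_)
    rw [← hβ, Submodule.span_le]
    rintro _ ⟨x, y, rfl⟩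
    refine (Submodule.span_le.mpr ?_) (hs x y)
    rintro _ rfl
    exact ⟨y₁, rfl⟩
  push Not at hs
  obtain ⟨x₂, y₂, h12⟩ := hs
  have h2' : β x₂ y₂ ≠ 0 := fun h => h12 (h ▸ Submodule.zero_mem _)
  have hz : ∀ w, w ∈ Submodule.span R {β x₁ y₁} → w ∈ Submodule.span R {β x₂ y₂} → w = 0 := by
    intro w hw1 hw2
    by_contra hw
    obtain ⟨r, rfl⟩ := Submodule.mem_span_singleton.mp hw2
    have hr : IsUnit (Ideal.Quotient.mk P r) := by
      let := Ideal.Quotient.field P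
      refine IsUnit.mk0 _ fun h => hw ?_
      rw [← algebraMap_smul (R ⧸ P) r, Ideal.Quotient.algebraMap_eq, h, zero_smul]
    obtain ⟨c, hc⟩ := hr.exists_left_inv
    obtain ⟨t, rfl⟩ := Ideal.Quotient.mk_surjective c
    refine h12 ?_
    have : β x₂ y₂ = t • r • β x₂ y₂ := by
      rw [smul_smul, ← algebraMap_smul (R ⧸ P) (t * r), Ideal.Quotient.algebraMap_eq, map_mul, hc,
        one_smul]
    rw [this]
    exact Submodule.smul_mem _ _ hw1
  have h12' : β x₁ y₂ = 0 := hz _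
    (key _ (hA x₁) _ ⟨y₁, rfl⟩ h1 _ ⟨y₂, rfl⟩) (key _ (hB y₂) _ ⟨x₂, rfl⟩ h2' _ ⟨x₁, rfl⟩)
  have h21 : β x₂ y₁ = 0 := hz _
    (key _ (hB y₁) _ ⟨x₁, rfl⟩ h1 _ ⟨x₂, rfl⟩) (key _ (hA x₂) _ ⟨y₂, rfl⟩ h2' _ ⟨y₁, rfl⟩)
  refine hA (x₁ + x₂) (eq_top_of_finrank_le_two P h2 h1 h12 _ ⟨y₁, ?_⟩ ⟨y₂, ?_⟩)
  · simp [h21]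
  · simp [h12']

end LinearAlgebra

/-! ### Primes of an order -/

section Primes

variable {Z Q K : Type*} [CommRing Z] [IsDedekindDomain Z] [Field Q] [Algebra Z Q]
  [IsFractionRing Z Q] [CommRing K] [Algebra Q K] [Algebra Z K]
  [IsScalarTower Z Q K] {T : Subalgebra Z K}

omit [IsDedekindDomain Z] [IsFractionRing Z Q] in
theorem IsOrder.isIntegral (hT : IsOrder Q T) : Algebra.IsIntegral Z T :=
  have := hT.moduleFinite
  Algebra.IsIntegral.of_finite Z T

omit [IsFractionRing Z Q] in
theorem exists_ne_zero_algebraMap_mem (hZ : ¬ IsField Z) (hT : IsOrder Q T) (P : Ideal T)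
    [P.IsMaximal] : ∃ c : Z, c ≠ 0 ∧ algebraMap Z T c ∈ P := by
  have := hT.isIntegral
  have hm : (P.comap (algebraMap Z T)).IsMaximal :=
    Ideal.isMaximal_comap_of_isIntegral_of_isMaximal P
  obtain ⟨c, hc, hc0⟩ := Submodule.exists_mem_ne_zero_of_ne_bot
    (Ring.ne_bot_of_isMaximal_of_not_isField hm hZ)
  exact ⟨c, hc0, hc⟩

omit [IsFractionRing Z Q] in
theorem isMaximal_of_algebraMap_mem (hT : IsOrder Q T) (P : Ideal T) [P.IsPrime] {c : Z}
    (hc : c ≠ 0) (hcP : algebraMap Z T c ∈ P) : P.IsMaximal := by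
  have := hT.isIntegral
  have hp : (P.comap (algebraMap Z T)).IsPrime := Ideal.IsPrime.comap _
  refine Ideal.isMaximal_of_isIntegral_of_isMaximal_comap (R := Z) P (hp.isMaximal fun h => hc ?_)
  have : c ∈ P.comap (algebraMap Z T) := hcP
  rwa [h] at this

/-- Every element of a fractional ideal `I` is congruent modulo `P I` to a unit of `K` in `I`:
there is room to move since `Z` is infinite. -/
theorem exists_isUnit_sub_mem [Module.Finite Q K] (hZ : ¬ IsField Z) (hT : IsOrder Q T)
    (P : Ideal T) [P.IsMaximal] {I : Submodule T K} (hI : IsFracIdeal Q I) {x : K} (hx : x ∈ I) :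
    ∃ y ∈ I, IsUnit y ∧ x - y ∈ P • I := by
  obtain ⟨c, hc, hcP⟩ := exists_ne_zero_algebraMap_mem hZ hT P
  obtain ⟨d, hd, hdI⟩ := hI.exists_smul_mem 1
  -- the element sought is `x - t c d` for some `t ∈ Z`, where `c ∈ P` and `d ∈ I`: all but finitely
  -- many such `t` avoid the eigenvalues of multiplication by `x`
  have : Infinite Z := by
    by_contra h
    rw [not_infinite_iff_finite] at h
    exact hZ (Finite.isField_of_domain Z)
  have hfin : (spectrum Q (Algebra.lmul Q K x)).Finite :=
    Module.End.finite_spectrum _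
  have hinj : Function.Injective fun t : Z => algebraMap Z Q (t * (c * d)) := fun s t hst =>
    mul_right_cancel₀ (mul_ne_zero hc hd) (IsFractionRing.injective Z Q hst)
  obtain ⟨t, ht⟩ : ∃ t : Z, algebraMap Z Q (t * (c * d)) ∉ spectrum Q (Algebra.lmul Q K x) := by
    by_contra! h
    exact Set.infinite_univ (Set.Finite.subset (hfin.preimage hinj.injOn) fun t _ => h t)
  rw [spectrum.notMem_iff, ← AlgHom.commutes (Algebra.lmul Q K), ← map_sub] at ht
  have hu : IsUnit (x - algebraMap Z K (t * (c * d))) := by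
    rw [Module.End.isUnit_iff] at ht
    obtain ⟨w, hw⟩ := ht.2 1
    refine IsUnit.of_mul_eq_one (-w) ?_
    rw [IsScalarTower.algebraMap_apply Z Q K]
    change (_ - x) * w = 1 at hw
    linear_combination hw
  have hm : algebraMap Z K (t * (c * d)) ∈ P • I := by
    have : algebraMap Z K (t * (c * d)) = algebraMap Z T (t * c) • (d • (1 : K)) := by
      rw [Algebra.smul_def d, mul_one, Algebra.smul_def, ← mul_assoc, map_mul]
      rfl
    rw [this]
    refine Submodule.smul_mem_smul ?_ hdI
    rw [map_mul]
    exact P.mul_mem_left _ hcP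
  refine ⟨_, I.sub_mem hx (Submodule.smul_le_right hm), hu, ?_⟩
  rwa [sub_sub_cancel]

end Primes

/-! ### Passing from `U / P U` to `U` -/

section Quotient

variable {R M A B : Type*} [CommRing R] [AddCommGroup M] [Module R M] [AddCommGroup A] [Module R A]
  [AddCommGroup B] [Module R B]

theorem mk_eq_mk_iff_sub_mem (P : Ideal R) {U : Submodule R M} (u v : U) :
    (Submodule.Quotient.mk u : U ⧸ (P • ⊤ : Submodule R U)) = Submodule.Quotient.mk v ↔
      (u - v : M) ∈ P • U := by
  rw [Submodule.Quotient.eq, Submodule.mem_smul_top_iff]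
  rfl

theorem isScalarTower_quotient_smul_top (P : Ideal R) :
    IsScalarTower R (R ⧸ P) (M ⧸ (P • ⊤ : Submodule R M)) := by
  refine ⟨fun r c m => ?_⟩
  obtain ⟨c, rfl⟩ := Ideal.Quotient.mk_surjective c
  obtain ⟨m, rfl⟩ := Submodule.Quotient.mk_surjective _ m
  change Submodule.Quotient.mk ((r • c) • m) = Submodule.Quotient.mk (r • c • m)
  rw [smul_assoc]

theorem finite_quotient_smul_top (P : Ideal R) [Module.Finite R M] :
    Module.Finite (R ⧸ P) (M ⧸ (P • ⊤ : Submodule R M)) :=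
  have := isScalarTower_quotient_smul_top (M := M) P
  Module.Finite.of_restrictScalars_finite R (R ⧸ P) _

/-- If `U` is spanned by the values of a bilinear map `β` and `U / P U` has dimension at most `2`,
then modulo `P` all of `U` is reached by `β x` for a single `x`, or by `β · y` for a single `y`. -/
theorem exists_surjective_mod_of_finrank_le_two (P : Ideal R) [P.IsMaximal] {U : Submodule R M}
    (hU : U.FG) (h2 : Module.finrank (R ⧸ P) (U ⧸ (P • ⊤ : Submodule R U)) ≤ 2)
    (β : A →ₗ[R] B →ₗ[R] M) (hβ : Submodule.span R {u | ∃ x y, β x y = u} = U) :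
    (∃ x, ∀ u ∈ U, ∃ y, u - β x y ∈ P • U) ∨ ∃ y, ∀ u ∈ U, ∃ x, u - β x y ∈ P • U := by
  have : Module.Finite R U := Module.Finite.iff_fg.mpr hU
  have := isScalarTower_quotient_smul_top (M := U) P
  have := finite_quotient_smul_top (M := U) P
  have hmem : ∀ x y, β x y ∈ U := fun x y => hβ ▸ Submodule.subset_span ⟨x, y, rfl⟩
  let γ : A →ₗ[R] B →ₗ[R] (U ⧸ (P • ⊤ : Submodule R U)) :=
    LinearMap.mk₂ R (fun x y => Submodule.Quotient.mk ⟨β x y, hmem x y⟩)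
      (fun a b c => by
        rw [← Submodule.Quotient.mk_add]; congr 1; ext; simp)
      (fun r a c => by
        rw [← Submodule.Quotient.mk_smul]; congr 1; ext; simp)
      (fun a b c => by
        rw [← Submodule.Quotient.mk_add]; congr 1; ext; simp)
      (fun r a c => by
        rw [← Submodule.Quotient.mk_smul]; congr 1; ext; simp)
  have hspan : Submodule.span R {u | ∃ x y, γ x y = u} = ⊤ := by
    have key : ∀ u ∈ Submodule.span R {u | ∃ x y, β x y = u}, ∀ hu : u ∈ U,
        Submodule.Quotient.mk ⟨u, hu⟩ ∈ Submodule.span R {u | ∃ x y, γ x y = u} := by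
      intro u hu
      induction hu using Submodule.span_induction with
      | mem u h =>
        obtain ⟨x, y, rfl⟩ := h
        exact fun _ => Submodule.subset_span ⟨x, y, rfl⟩
      | zero => exact fun _ => Submodule.zero_mem _
      | add a b ha hb iha ihb =>
        exact fun _ => Submodule.add_mem _ (iha (hβ ▸ ha)) (ihb (hβ ▸ hb))
      | smul r a ha iha => exact fun _ => Submodule.smul_mem _ r (iha (hβ ▸ ha))
    refine eq_top_iff.mpr fun w _ => ?_
    obtain ⟨⟨u, hu⟩, rfl⟩ := Submodule.Quotient.mk_surjective _ w
    exact key u (hβ ▸ hu) hu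
  refine (exists_surjective_of_finrank_le_two P h2 γ hspan).imp ?_ ?_
  · rintro ⟨x, hx⟩
    refine ⟨x, fun u hu => ?_⟩
    obtain ⟨y, e⟩ := LinearMap.range_eq_top.mp hx (Submodule.Quotient.mk ⟨u, hu⟩)
    exact ⟨y, (mk_eq_mk_iff_sub_mem P _ _).mp e.symm⟩
  · rintro ⟨y, hy⟩
    refine ⟨y, fun u hu => ?_⟩
    obtain ⟨x, e⟩ := LinearMap.range_eq_top.mp hy (Submodule.Quotient.mk ⟨u, hu⟩)
    exact ⟨x, (mk_eq_mk_iff_sub_mem P _ _).mp e.symm⟩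

theorem exists_sub_smul_mem_of_finrank_le_one (P : Ideal R) [P.IsMaximal] {U : Submodule R M}
    (hU : U.FG) (h1 : Module.finrank (R ⧸ P) (U ⧸ (P • ⊤ : Submodule R U)) ≤ 1) :
    ∃ x ∈ U, ∀ u ∈ U, ∃ r : R, u - r • x ∈ P • U := by
  let := Ideal.Quotient.field P
  have : Module.Finite R U := Module.Finite.iff_fg.mpr hU
  have := finite_quotient_smul_top (M := U) P
  rw [finrank_le_one_iff] at h1
  obtain ⟨v, hv⟩ := h1
  obtain ⟨x, rfl⟩ := Submodule.Quotient.mk_surjective _ v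
  refine ⟨x, x.2, fun u hu => ?_⟩
  obtain ⟨c, hc⟩ := hv (Submodule.Quotient.mk ⟨u, hu⟩)
  obtain ⟨r, rfl⟩ := Ideal.Quotient.mk_surjective c
  exact ⟨r, (mk_eq_mk_iff_sub_mem P _ (r • x)).mp hc.symm⟩

theorem finrank_le_one_of_smul_eq_smul (P : Ideal R) [P.IsMaximal] {U : Submodule R M} {x : M}
    (hx : x ∈ U) {s : R} (hs : s ∉ P) (h : ∀ u ∈ U, ∃ t : R, t • x = s • u) :
    Module.finrank (R ⧸ P) (U ⧸ (P • ⊤ : Submodule R U)) ≤ 1 := by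
  let := Ideal.Quotient.field P
  refine finrank_le_one (Submodule.Quotient.mk ⟨x, hx⟩) fun w => ?_
  obtain ⟨⟨u, hu⟩, rfl⟩ := Submodule.Quotient.mk_surjective _ w
  obtain ⟨t, ht⟩ := h u hu
  have hs0 : Ideal.Quotient.mk P s ≠ 0 := fun h => hs (Ideal.Quotient.eq_zero_iff_mem.mp h)
  refine ⟨(Ideal.Quotient.mk P s)⁻¹ * Ideal.Quotient.mk P t, ?_⟩
  rw [mul_smul, inv_smul_eq_iff₀ hs0]
  exact congrArg Submodule.Quotient.mk (Subtype.ext ht : t • (⟨x, hx⟩ : U) = s • ⟨u, hu⟩)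

end Quotient

/-! ### The local dichotomy -/

section Local

variable {Z Q K : Type*} [CommRing Z] [IsDedekindDomain Z] [Field Q] [Algebra Z Q]
  [IsFractionRing Z Q] [CommRing K] [Algebra Q K] [Algebra Z K]
  [IsScalarTower Z Q K] {T : Subalgebra Z K}

omit [IsDedekindDomain Z] in
theorem mul_mem_div_one {x : K} {I : Submodule T K} (hx : x ∈ I) : x ∈ I / 1 := fun y hy => by
  obtain ⟨t, rfl⟩ := Submodule.mem_one.mp hy
  rw [mul_comm, ← Algebra.smul_def]
  exact I.smul_mem t hx

/-- Let `I J ⊆ U` be fractional ideals and let `x ∈ I` be such that `x J → U / P U` is surjective.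
Then, up to replacing `x` by a unit of `K` congruent to it modulo `P I`, the inclusion `x J ⊆ U`
becomes an equality after localization at `P`, by Nakayama's lemma. -/
theorem exists_isUnit_smul_mem [Module.Finite Q K] (hZ : ¬ IsField Z) (hT : IsOrder Q T)
    (P : Ideal T) [P.IsMaximal] {I J U : Submodule T K} (hI : IsFracIdeal Q I) (hU : U.FG)
    (h : I * J ≤ U) {x : K} (hx : x ∈ I) (hs : ∀ u ∈ U, ∃ y ∈ J, u - x * y ∈ P • U) :
    ∃ a : Kˣ, (a : K) ∈ I ∧ ∃ s : T, s ∉ P ∧ ∀ u ∈ U, (s : K) * ↑a⁻¹ * u ∈ J := by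
  obtain ⟨_, haI, ⟨a, rfl⟩, hxa⟩ := exists_isUnit_sub_mem hZ hT P hI hx
  have hle : U ≤ J.map (LinearMap.mulLeft T (a : K)) ⊔ P • U := by
    intro u hu
    obtain ⟨y, hy, huy⟩ := hs u hu
    have e : u = a * y + ((x - a) * y + (u - x * y)) := by ring
    rw [e]
    refine Submodule.add_mem_sup ⟨y, hy, rfl⟩ (Submodule.add_mem _ ?_ huy)
    refine Submodule.smul_induction_on hxa (fun p hp i hi => ?_) fun v w hv hw => ?_
    · rw [smul_mul_assoc]
      exact Submodule.smul_mem_smul hp (h (Submodule.mul_mem_mul hi hy))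
    · rw [add_mul]
      exact Submodule.add_mem _ hv hw
  obtain ⟨s, hs1, hsU⟩ := Submodule.exists_sub_one_mem_and_smul_le_of_fg_of_le_sup hU le_rfl hle
  refine ⟨a, haI, s, fun hsP => ?_, fun u hu => ?_⟩
  · have : (1 : T) ∈ P := by
      have := P.sub_mem hsP hs1
      rwa [sub_sub_cancel] at this
    exact Ideal.IsMaximal.ne_top ‹_› ((Ideal.eq_top_iff_one P).mpr this)
  · obtain ⟨y, hy, e⟩ := hsU (Submodule.smul_mem_pointwise_smul u s U hu)
    have e' : (a : K) * y = s * u := e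
    have : (s : K) * ↑a⁻¹ * u = y := by
      rw [mul_right_comm, ← e', mul_right_comm, Units.mul_inv, one_mul]
    rwa [this]

omit [IsDedekindDomain Z] [IsFractionRing Z Q] [IsScalarTower Z Q K] in
theorem typeAt_eq_finrank_dual_one (P : MaximalSpectrum T) :
    typeAt Q T P = Module.finrank (T ⧸ P.asIdeal)
      (dual Q (1 : Submodule T K) ⧸
        (P.asIdeal • ⊤ : Submodule T (dual Q (1 : Submodule T K)))) := by
  rw [typeAt, dual_one]

variable [Algebra.Etale Q K]

/-- At a prime where the type of `T` is at most `2`, an ideal with multiplicator ring `T` is locally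
isomorphic to `T` or to its trace dual. -/
theorem locEq_one_or_locEq_dual (hZ : ¬ IsField Z) (hT : IsOrder Q T) {I : Submodule T K}
    (hI : IsFracIdeal Q I) (hII : I / I = 1) (P : MaximalSpectrum T) (h2 : typeAt Q T P ≤ 2) :
    LocEq P.asIdeal 1 I ∨ LocEq P.asIdeal (dual Q 1) I := by
  have : Module.Finite Q K := Algebra.FormallyUnramified.finite_of_free Q K
  have := P.isMaximal
  have hmul := mul_dual_eq hT hI hII
  rw [typeAt_eq_finrank_dual_one] at h2
  have hUfg := ((isFracIdeal_one hT).dual hT).1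
  let β : I →ₗ[T] dual Q I →ₗ[T] K := (LinearMap.mul T K).domRestrict₁₂ I (dual Q I)
  have hspan : Submodule.span T {u | ∃ x y, β x y = u} = dual Q 1 := by
    rw [← hmul, Submodule.mul_eq_span_mul_set]
    congr 1
    ext u
    exact ⟨fun ⟨x, y, h⟩ => ⟨x, x.2, y, y.2, h⟩,
      fun ⟨x, hx, y, hy, h⟩ => ⟨⟨x, hx⟩, ⟨y, hy⟩, h⟩⟩
  rcases exists_surjective_mod_of_finrank_le_two P.asIdeal hUfg h2 β hspan with ⟨x, hx⟩ | ⟨y, hy⟩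
  · obtain ⟨a, haI, s, hs, hsU⟩ := exists_isUnit_smul_mem hZ hT P.asIdeal hI hUfg hmul.le x.2
      fun u hu => by
        obtain ⟨y, e⟩ := hx u hu
        exact ⟨y, y.2, e⟩
    -- `b = s / a` maps `T^t` into `I^t`, so by duality it maps `I` into `T^tt = T`
    refine Or.inl ⟨a, mul_mem_div_one haI, s * ↑a⁻¹, fun w hw => ?_, s, hs, ?_⟩
    · rw [← dual_dual (isFracIdeal_one hT)]
      intro u hu
      rw [mul_right_comm]
      exact hsU u hu w hw
    · rw [mul_left_comm, Units.mul_inv, mul_one]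
  · rw [mul_comm] at hmul
    obtain ⟨a, haI, s, hs, hsU⟩ := exists_isUnit_smul_mem hZ hT P.asIdeal (hI.dual hT) hUfg hmul.le
      y.2 fun u hu => by
        obtain ⟨x, e⟩ := hy u hu
        refine ⟨x, x.2, ?_⟩
        rw [mul_comm]
        exact e
    refine Or.inr ⟨s * ↑a⁻¹, fun u hu => hsU u hu, a,
      fun w hw => hmul ▸ Submodule.mul_mem_mul haI hw, s, hs, ?_⟩
    rw [mul_assoc, Units.inv_mul, mul_one]

/-- At a prime where `T^t / P T^t` is cyclic, the trace dual is locally principal. -/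
theorem locEq_one_dual_of_typeAt_le_one (hZ : ¬ IsField Z) (hT : IsOrder Q T)
    (P : MaximalSpectrum T) (h1 : typeAt Q T P ≤ 1) :
    LocEq P.asIdeal (1 : Submodule T K) (dual Q 1) := by
  have : Module.Finite Q K := Algebra.FormallyUnramified.finite_of_free Q K
  have := P.isMaximal
  have hU := (isFracIdeal_one hT).dual hT
  rw [typeAt_eq_finrank_dual_one] at h1
  obtain ⟨x, hx, h⟩ := exists_sub_smul_mem_of_finrank_le_one P.asIdeal hU.1 h1
  obtain ⟨a, haI, s, hs, hsU⟩ := exists_isUnit_smul_mem hZ hT P.asIdeal hU hU.1 (J := 1)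
      (mul_one _).le hx fun u hu => by
    obtain ⟨r, hr⟩ := h u hu
    refine ⟨r, Submodule.mem_one.mpr ⟨r, rfl⟩, ?_⟩
    rw [mul_comm]
    exact hr
  refine ⟨a, mul_mem_div_one haI, s * ↑a⁻¹, fun u hu => hsU u hu, s, hs, ?_⟩
  rw [mul_left_comm, Units.mul_inv, mul_one]

omit [IsDedekindDomain Z] [IsFractionRing Z Q] [IsScalarTower Z Q K] [Algebra.Etale Q K] in
theorem typeAt_le_one_of_locEq_one_dual
    (P : MaximalSpectrum T) (h : LocEq P.asIdeal (1 : Submodule T K) (dual Q 1)) :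
    typeAt Q T P ≤ 1 := by
  have := P.isMaximal
  obtain ⟨a, ha, b, hb, s, hs, e⟩ := h
  have haU : a ∈ dual Q (1 : Submodule T K) := by
    simpa using ha 1 (Submodule.one_le.mp le_rfl)
  rw [typeAt_eq_finrank_dual_one]
  refine finrank_le_one_of_smul_eq_smul P.asIdeal haU hs fun u hu => ?_
  obtain ⟨t, ht⟩ := Submodule.mem_one.mp (hb u hu)
  refine ⟨t, ?_⟩
  change (t : K) * a = s * u
  rw [← e, mul_assoc, ← ht, mul_comm]
  rfl

end Local

/-! ### Gluing at finitely many primes -/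

section Construction

variable {Z Q K : Type*} [CommRing Z] [IsDedekindDomain Z] [Field Q] [Algebra Z Q]
  [IsFractionRing Z Q] [CommRing K] [Algebra Q K] [Algebra Z K]
  [IsScalarTower Z Q K] {T : Subalgebra Z K}

omit [IsFractionRing Z Q] in
theorem isMaximal_of_mem_minimalPrimes (hT : IsOrder Q T) {c : Z} (hc : c ≠ 0) {p : Ideal T}
    (hp : p ∈ (Ideal.span {algebraMap Z T c}).minimalPrimes) : p.IsMaximal := by
  have := hp.1.1
  exact isMaximal_of_algebraMap_mem hT p hc (hp.1.2 (Ideal.mem_span_singleton_self _))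

omit [IsFractionRing Z Q] in
theorem finite_setOf_algebraMap_mem (hT : IsOrder Q T) {c : Z} (hc : c ≠ 0) :
    {P : MaximalSpectrum T | algebraMap Z T c ∈ P.asIdeal}.Finite := by
  have := hT.isNoetherianRing
  refine Set.Finite.of_finite_image (f := MaximalSpectrum.asIdeal)
    ((Ideal.finite_minimalPrimes_of_isNoetherianRing T (Ideal.span {algebraMap Z T c})).subset ?_)
    fun P _ P' _ h => MaximalSpectrum.ext h
  rintro _ ⟨P, hP, rfl⟩
  have := P.isMaximal
  obtain ⟨p, hp, hle⟩ := Ideal.exists_minimalPrimes_le (J := P.asIdeal)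
    ((Ideal.span_singleton_le_iff_mem _).mpr hP)
  have hpm := isMaximal_of_mem_minimalPrimes hT hc hp
  rwa [← hpm.eq_of_le P.isMaximal.ne_top hle]

omit [IsFractionRing Z Q] in
/-- A nonzero `c ∈ Z` generates an ideal of `T` that contains a product `𝔟 𝔤`, where `𝔟` is a
product of primes in a given set `E` and `𝔤` is a product of primes outside `E`. -/
theorem exists_mul_le_span_of_set (hT : IsOrder Q T) {c : Z} (hc : c ≠ 0)
    (E : Set (MaximalSpectrum T)) :
    ∃ 𝔟 𝔤 : Ideal T, 𝔟 * 𝔤 ≤ Ideal.span {algebraMap Z T c} ∧ (∀ P ∉ E, ¬ 𝔟 ≤ P.asIdeal) ∧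
      ∀ P ∈ E, ¬ 𝔤 ≤ P.asIdeal := by
  classical
  have := hT.isNoetherianRing
  set I := Ideal.span {algebraMap Z T c}
  have hfin := Ideal.finite_minimalPrimes_of_isNoetherianRing T I
  let F := hfin.toFinset
  have hF : ∀ p ∈ F, p.IsMaximal := fun p hp =>
    isMaximal_of_mem_minimalPrimes hT hc (hfin.mem_toFinset.mp hp)
  obtain ⟨n, hn⟩ := Ideal.exists_radical_pow_le_of_fg I (IsNoetherian.noetherian _)
  have key : ∀ G ⊆ F, ∀ P : MaximalSpectrum T, (∏ p ∈ G, p) ^ n ≤ P.asIdeal → P.asIdeal ∈ G := by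
    intro G hG P h
    have := P.isMaximal.isPrime
    obtain ⟨p, hp, hle⟩ := (Ideal.IsPrime.prod_le this).mp (Ideal.IsPrime.le_of_pow_le h)
    rwa [← (hF p (hG hp)).eq_of_le P.isMaximal.ne_top hle]
  refine ⟨(∏ p ∈ F with p ∈ MaximalSpectrum.asIdeal '' E, p) ^ n,
    (∏ p ∈ F with ¬ p ∈ MaximalSpectrum.asIdeal '' E, p) ^ n, ?_, fun P hP h => ?_,
    fun P hP h => ?_⟩
  · rw [← mul_pow, Finset.prod_filter_mul_prod_filter_not]
    refine (Ideal.pow_right_mono ?_ n).trans hn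
    rw [← Ideal.sInf_minimalPrimes]
    refine le_sInf fun p hp => ?_
    exact Ideal.prod_le_inf.trans (Finset.inf_le (f := fun p => p) (hfin.mem_toFinset.mpr hp))
  · obtain ⟨P', hP', e⟩ := (Finset.mem_filter.mp (key _ (Finset.filter_subset _ _) P h)).2
    exact hP (MaximalSpectrum.ext e ▸ hP')
  · exact (Finset.mem_filter.mp (key _ (Finset.filter_subset _ _) P h)).2 ⟨P, hP, rfl⟩

/-- A fractional ideal `D` may be glued with `T`: for every set `E` of primes of `T` there is a
fractional ideal that looks like `D` at the primes in `E` and like `T` at all others. -/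
theorem exists_locEq_of_set (hT : IsOrder Q T) {D : Submodule T K} (hD : IsFracIdeal Q D)
    (hD1 : IsFracIdeal Q (1 / D)) (E : Set (MaximalSpectrum T)) :
    ∃ I : Submodule T K, IsFracIdeal Q I ∧ (∀ P ∈ E, LocEq P.asIdeal D I) ∧
      ∀ P ∉ E, LocEq P.asIdeal 1 I := by
  obtain ⟨c, hc, hcD⟩ := hD1.exists_smul_mem 1
  obtain ⟨d, hd, hdD⟩ := hD.exists_smul_mem 1
  rw [Algebra.smul_def, mul_one] at hcD hdD
  obtain ⟨𝔟, 𝔤, hle, h𝔟, h𝔤⟩ := exists_mul_le_span_of_set hT (mul_ne_zero hc hd) E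
  let D' := D.map (LinearMap.mulLeft T (algebraMap Z K c))
  let B : Submodule T K := Submodule.map (Algebra.linearMap T K) 𝔟
  have hD'1 : D' ≤ 1 := by
    rintro _ ⟨x, hx, rfl⟩
    exact hcD x hx
  have hB1 : B ≤ 1 := by
    rintro _ ⟨t, ht, rfl⟩
    exact Submodule.mem_one.mpr ⟨t, rfl⟩
  have hcd : algebraMap Z K (c * d) ∈ D' := ⟨_, hdD, (map_mul _ _ _).symm⟩
  obtain ⟨u, hu⟩ := isUnit_algebraMap Q K hc
  refine ⟨D' ⊔ B, ?_, fun P hP => ?_, fun P hP => ?_⟩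
  · refine (isFracIdeal_one hT).of_le_of_smul_mem hT (sup_le hD'1 hB1) fun x => ?_
    obtain ⟨z, hz, hx⟩ := (isFracIdeal_one hT).exists_smul_mem x
    refine ⟨c * d * z, mul_ne_zero (mul_ne_zero hc hd) hz, ?_⟩
    obtain ⟨t, ht⟩ := Submodule.mem_one.mp hx
    rw [mul_smul, ← ht, Algebra.smul_def, mul_comm, ← Algebra.smul_def]
    exact Submodule.smul_mem _ _ (Submodule.mem_sup_left hcd)
  · obtain ⟨s, hs, hsP⟩ := Set.not_subset.mp (h𝔤 P hP)
    refine ⟨u, fun x hx => ?_, s * ↑u⁻¹, ?_, s, hsP, ?_⟩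
    · rw [hu]
      exact Submodule.mem_sup_left ⟨x, hx, rfl⟩
    · have hsD : ∀ y ∈ D' ⊔ B, s • y ∈ D' := by
        intro y hy
        obtain ⟨y₁, hy₁, _, ⟨t, ht, rfl⟩, rfl⟩ := Submodule.mem_sup.mp hy
        rw [smul_add]
        refine D'.add_mem (D'.smul_mem s hy₁) ?_
        obtain ⟨r, hr⟩ := Ideal.mem_span_singleton'.mp (hle (Ideal.mul_mem_mul ht hs))
        have : s • (Algebra.linearMap T K) t = r • algebraMap Z K (c * d) := by
          rw [Algebra.linearMap_apply, Algebra.smul_def, ← map_mul, mul_comm, ← hr, map_mul,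
            Algebra.smul_def]
          rfl
        rw [this]
        exact D'.smul_mem r hcd
      intro y hy
      obtain ⟨x, hx, e⟩ := hsD y hy
      have e' : (u : K) * x = s * y := by rw [hu]; exact e
      rwa [mul_right_comm, ← e', mul_right_comm, Units.mul_inv, one_mul]
    · rw [mul_left_comm, Units.mul_inv, mul_one]
  · obtain ⟨s, hs, hsP⟩ := Set.not_subset.mp (h𝔟 P hP)
    refine ⟨s, mul_mem_div_one (Submodule.mem_sup_right ⟨s, hs, rfl⟩), 1, fun y hy => ?_, s, hsP,
      mul_one _⟩
    rw [one_mul]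
    exact sup_le hD'1 hB1 hy

/-- A fractional ideal is locally isomorphic to `T` at all but finitely many primes. -/
theorem finite_setOf_not_locEq_one (hT : IsOrder Q T) {D : Submodule T K} (hD : IsFracIdeal Q D)
    (hD1 : IsFracIdeal Q (1 / D)) :
    {P : MaximalSpectrum T | ¬ LocEq P.asIdeal 1 D}.Finite := by
  obtain ⟨c, hc, hcD⟩ := hD1.exists_smul_mem 1
  obtain ⟨d, hd, hdD⟩ := hD.exists_smul_mem 1
  rw [Algebra.smul_def, mul_one] at hcD hdD
  refine (finite_setOf_algebraMap_mem hT (mul_ne_zero hd hc)).subset fun P hP => ?_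
  by_contra h
  exact hP ⟨_, mul_mem_div_one hdD, _, hcD, _, h, (map_mul (algebraMap Z K) _ _).symm⟩

/-- A weak form of the principality of invertible modules over a semilocal ring: if `L M = T` then
for every nonzero `c ∈ Z` there are `a ∈ L` and `b ∈ M` whose product is an integer congruent to
`1` modulo `c`. -/
theorem exists_mul_eq_algebraMap (hT : IsOrder Q T) {L M : Submodule T K} (hLM : L * M = 1)
    {c : Z} (hc : c ≠ 0) :
    ∃ a ∈ L, ∃ b ∈ M, ∃ z : Z, c ∣ z - 1 ∧ a * b = algebraMap Z K z := by
  classical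
  have hfin := finite_setOf_algebraMap_mem hT hc
  let F := hfin.toFinset
  have hloc := fun P : MaximalSpectrum T =>
    exists_mul_notMem_of_mul_eq_one hLM P.asIdeal P.isMaximal.ne_top
  choose l hl m hm s hs hlm using hloc
  -- among the primes in `F`, `e P` lies outside `P` only, so that `a = ∑ e P * l P`
  -- generates `L` at every prime in `F`
  have hsep : ∀ P : MaximalSpectrum T, ∃ e : T, e ∉ P.asIdeal ∧
      ∀ P' ∈ F, P' ≠ P → e ∈ P'.asIdeal := by
    intro P
    have hP := P.isMaximal.isPrime
    have : ¬ (∏ P' ∈ F.erase P, P'.asIdeal) ≤ P.asIdeal := fun h => by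
      obtain ⟨P', hP', hle⟩ := (Ideal.IsPrime.prod_le hP).mp h
      exact (Finset.mem_erase.mp hP').1
        (MaximalSpectrum.ext (P'.isMaximal.eq_of_le P.isMaximal.ne_top hle))
    obtain ⟨e, he, heP⟩ := Set.not_subset.mp this
    refine ⟨e, heP, fun P' hP' hne => ?_⟩
    exact (Ideal.prod_le_inf.trans
      (Finset.inf_le (f := fun P : MaximalSpectrum T => P.asIdeal)
        (Finset.mem_erase.mpr ⟨hne, hP'⟩))) he
  choose e heP he using hsep
  let a := ∑ P ∈ F, e P • l P
  have haL : a ∈ L := L.sum_mem fun P _ => L.smul_mem _ (hl P)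
  have hone : (1 : K) ∈ M.map (LinearMap.mulLeft T a) ⊔ Submodule.span T {algebraMap Z K c} := by
    refine one_mem_of_forall_maximal _ fun P => ?_
    by_cases hP : algebraMap Z T c ∈ P.asIdeal
    · have hPF : P ∈ F := hfin.mem_toFinset.mpr hP
      choose t ht using fun P' =>
        Submodule.mem_one.mp (hLM.le (Submodule.mul_mem_mul (hl P') (hm P)))
      have htP : t P = s P := Subtype.ext ((ht P).trans (hlm P))
      refine ⟨∑ P' ∈ F, e P' * t P', fun h => ?_, Submodule.mem_sup_left ⟨m P, hm P, ?_⟩⟩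
      · rw [← Finset.add_sum_erase _ _ hPF] at h
        have h2 : ∑ P' ∈ F.erase P, e P' * t P' ∈ P.asIdeal :=
          Submodule.sum_mem _ fun P' hP' => P.asIdeal.mul_mem_right _
            (he P' P hPF (Finset.mem_erase.mp hP').1.symm)
        have h3 := (Submodule.add_mem_iff_left _ h2).mp h
        rw [htP] at h3
        exact (P.isMaximal.isPrime.mem_or_mem h3).elim (heP P) (hs P)
      · rw [LinearMap.mulLeft_apply, Finset.sum_mul]
        change _ = algebraMap T K _
        rw [map_sum]
        refine Finset.sum_congr rfl fun P' _ => ?_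
        rw [map_mul, ht, Algebra.smul_def, mul_assoc]
    · exact ⟨_, hP, Submodule.mem_sup_right (Submodule.mem_span_singleton_self _)⟩
  have hN : ((1 : Submodule T K).restrictScalars Z) ≤
      (M.map (LinearMap.mulLeft T a)).restrictScalars Z ⊔
        Ideal.span {c} • ((1 : Submodule T K).restrictScalars Z) := by
    intro x hx
    obtain ⟨t, rfl⟩ := Submodule.mem_one.mp hx
    obtain ⟨y, hy, w, hw, hyw⟩ := Submodule.mem_sup.mp hone
    obtain ⟨r, rfl⟩ := Submodule.mem_span_singleton.mp hw
    have : algebraMap T K t = t • y + c • ((t * r : T) : K) := by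
      rw [← mul_one (algebraMap T K t), ← hyw, mul_add, ← Algebra.smul_def, Algebra.smul_def c,
        Algebra.smul_def r]
      congr 1
      change (t : K) * (r * algebraMap Z K c) = algebraMap Z K c * (t * r)
      ring
    rw [this]
    refine Submodule.add_mem_sup ?_ ?_
    · exact Submodule.smul_mem (M.map (LinearMap.mulLeft T a)) t hy
    · refine Submodule.smul_mem_smul (Ideal.mem_span_singleton_self c) ?_
      exact Submodule.mem_one.mpr ⟨t * r, rfl⟩
  obtain ⟨z, hz, hzN⟩ := Submodule.exists_sub_one_mem_and_smul_le_of_fg_of_le_sup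
    (isFracIdeal_one hT).2.fg le_rfl hN
  have h1 : (1 : K) ∈ (1 : Submodule T K) := Submodule.one_le.mp le_rfl
  obtain ⟨b, hb, hab⟩ := hzN (Submodule.smul_mem_pointwise_smul _ z
    ((1 : Submodule T K).restrictScalars Z) h1)
  refine ⟨a, haL, b, hb, z, Ideal.mem_span_singleton.mp hz, ?_⟩
  rw [← mul_one (algebraMap Z K z), ← Algebra.smul_def]
  exact hab

end Construction

/-! ### Isomorphisms of localized modules -/

section Localization

variable {R M N : Type*} [CommRing R] [AddCommGroup M] [Module R M] [AddCommGroup N] [Module R N]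
  {p : Ideal R} [p.IsPrime]

theorem nonempty_localized_linearEquiv_of_comp_eq_smul (f : M →ₗ[R] N) (g : N →ₗ[R] M) {s : R}
    (hs : s ∉ p) (hgf : ∀ x, g (f x) = s • x) (hfg : ∀ y, f (g y) = s • y) :
    Nonempty (LocalizedModule p.primeCompl M ≃ₗ[Localization.AtPrime p]
      LocalizedModule p.primeCompl N) := by
  refine ⟨LinearEquiv.ofBijective (LocalizedModule.map p.primeCompl f) ⟨?_, ?_⟩⟩
  · refine (injective_iff_map_eq_zero _).mpr fun w hw => ?_
    induction w using LocalizedModule.induction_on with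
    | h x t =>
      rw [LocalizedModule.map_mk, ← LocalizedModule.zero_mk 1, LocalizedModule.mk_eq] at hw
      obtain ⟨u, hu⟩ := hw
      rw [one_smul, smul_zero, smul_zero] at hu
      rw [← LocalizedModule.zero_mk 1, LocalizedModule.mk_eq]
      refine ⟨u * ⟨s, hs⟩, ?_⟩
      rw [Submonoid.smul_def] at hu
      rw [one_smul, smul_zero, smul_zero, mul_smul, Submonoid.smul_def]
      change (u : R) • s • x = 0
      rw [← hgf, ← map_smul, ← map_smul, map_smul f, hu, map_zero]
  · intro w
    induction w using LocalizedModule.induction_on with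
    | h y t =>
      refine ⟨LocalizedModule.mk (g y) (⟨s, hs⟩ * t), ?_⟩
      rw [LocalizedModule.map_mk, hfg]
      exact LocalizedModule.mk_cancel_common_left ⟨s, hs⟩ t y

theorem exists_comp_eq_smul_of_localized_linearEquiv [IsNoetherianRing R] [Module.Finite R M]
    [Module.Finite R N] (φ : LocalizedModule p.primeCompl M ≃ₗ[Localization.AtPrime p]
      LocalizedModule p.primeCompl N) :
    ∃ (f : M →ₗ[R] N) (g : N →ₗ[R] M) (s : R), s ∉ p ∧
      ∀ x, ∃ u ∉ p, u • g (f x) = u • s • x := by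
  have := Module.finitePresentation_of_finite R M
  have := Module.finitePresentation_of_finite R N
  let ψ := φ.restrictScalars R
  obtain ⟨f, s, hf⟩ := Module.FinitePresentation.exists_lift_of_isLocalizedModule p.primeCompl
    (LocalizedModule.mkLinearMap p.primeCompl N)
    (ψ.toLinearMap ∘ₗ LocalizedModule.mkLinearMap p.primeCompl M)
  obtain ⟨g, t, hg⟩ := Module.FinitePresentation.exists_lift_of_isLocalizedModule p.primeCompl
    (LocalizedModule.mkLinearMap p.primeCompl M)
    (ψ.symm.toLinearMap ∘ₗ LocalizedModule.mkLinearMap p.primeCompl N)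
  have hf' : ∀ x, LocalizedModule.mkLinearMap p.primeCompl N (f x) =
      (s : R) • ψ (LocalizedModule.mkLinearMap p.primeCompl M x) := fun x =>
    LinearMap.congr_fun hf x
  have hg' : ∀ y, LocalizedModule.mkLinearMap p.primeCompl M (g y) =
      (t : R) • ψ.symm (LocalizedModule.mkLinearMap p.primeCompl N y) := fun y =>
    LinearMap.congr_fun hg y
  refine ⟨f, g, t * s, (t * s).2, fun x => ?_⟩
  have h1 : LocalizedModule.mkLinearMap p.primeCompl M (g (f x)) =
      LocalizedModule.mkLinearMap p.primeCompl M ((t * s : R) • x) := by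
    rw [hg', hf', map_smul, ψ.symm_apply_apply, map_smul, mul_smul]
  obtain ⟨u, hu⟩ := (IsLocalizedModule.eq_iff_exists p.primeCompl _).mp h1
  exact ⟨u, u.2, hu⟩

end Localization

/-! ### Isomorphisms as multiplications -/

section Isomorphism

variable {Z Q K : Type*} [CommRing Z] [IsDedekindDomain Z] [Field Q] [Algebra Z Q]
  [IsFractionRing Z Q] [CommRing K] [Algebra Q K] [Algebra Z K]
  [IsScalarTower Z Q K] {S : Subalgebra Z K}

/-- Elements of `K` that agree as multipliers on a fractional ideal are equal. -/
theorem IsFracIdeal.eq_of_mul_eq {I : Submodule S K} (hI : IsFracIdeal Q I) {a b : K}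
    (h : ∀ x ∈ I, a * x = b * x) : a = b := by
  obtain ⟨d, hd, hdI⟩ := hI.exists_smul_mem 1
  have := h _ hdI
  rw [Algebra.smul_def, mul_one] at this
  exact (isUnit_algebraMap Q K hd).mul_right_cancel this

/-- A linear map between fractional ideals is multiplication by an element of `K`. -/
theorem exists_eq_mul_of_linearMap (hS : IsOrder Q S) {I J : Submodule S K} (hI : IsFracIdeal Q I)
    (f : I →ₗ[S] J) : ∃ a : K, ∀ x : I, (f x : K) = a * x := by
  obtain ⟨d, hd, hdI⟩ := hI.exists_smul_mem 1
  obtain ⟨u, hu⟩ := isUnit_algebraMap Q K hd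
  refine ⟨↑u⁻¹ * f ⟨_, hdI⟩, fun x => ?_⟩
  obtain ⟨z, hz, hzx⟩ := exists_smul_mem_of_isLattice _ hS (x : K)
  obtain ⟨v, hv⟩ := isUnit_algebraMap Q K hz
  -- both sides compute `f` at `z d x`, read as a multiple of `d` and as a multiple of `x`
  have h1 : (⟨z • (x : K), hzx⟩ : S) • (⟨d • 1, hdI⟩ : I) = algebraMap Z S (z * d) • x := by
    ext
    change z • (x : K) * d • (1 : K) = algebraMap Z K (z * d) * x
    rw [Algebra.smul_def, Algebra.smul_def, map_mul]
    ring
  have h2 := congrArg (fun y => (f y : K)) h1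
  simp only [map_smul] at h2
  have h3 : z • (x : K) * (f ⟨_, hdI⟩ : K) = algebraMap Z K (z * d) * f x := h2
  rw [Algebra.smul_def, map_mul, ← hu, ← hv] at h3
  rw [mul_assoc, Units.eq_inv_mul_iff_mul_eq]
  refine v.isUnit.mul_left_cancel ?_
  linear_combination -h3

/-- Multiplication by `a ∈ (J : I)`, as a linear map. -/
def mulLinearMap {I J : Submodule S K} {a : K} (ha : a ∈ J / I) : I →ₗ[S] J where
  toFun x := ⟨a * x, ha x x.2⟩
  map_add' x y := Subtype.ext (mul_add a x y)
  map_smul' r x := Subtype.ext (mul_smul_comm r a (x : K))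

theorem nonempty_linearEquiv_iff (hS : IsOrder Q S) {I J : Submodule S K} (hI : IsFracIdeal Q I)
    (hJ : IsFracIdeal Q J) :
    Nonempty (I ≃ₗ[S] J) ↔ ∃ a : Kˣ, ∀ x : K, x ∈ I ↔ a * x ∈ J := by
  constructor
  · rintro ⟨e⟩
    obtain ⟨a, ha⟩ := exists_eq_mul_of_linearMap hS hI (e : I →ₗ[S] J)
    obtain ⟨b, hb⟩ := exists_eq_mul_of_linearMap hS hJ (e.symm : J →ₗ[S] I)
    have hba : b * a = 1 := by
      refine hI.eq_of_mul_eq fun x hx => ?_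
      have h1 := hb (e ⟨x, hx⟩)
      have h2 := ha ⟨x, hx⟩
      simp only [LinearEquiv.coe_coe, LinearEquiv.symm_apply_apply] at h1 h2
      rw [one_mul, mul_assoc, ← h2, ← h1]
    refine ⟨⟨a, b, by rw [mul_comm, hba], hba⟩, fun x => ⟨fun hx => ?_, fun hx => ?_⟩⟩
    · change a * x ∈ J
      rw [← ha ⟨x, hx⟩]
      exact (e ⟨x, hx⟩).2
    · have := hb ⟨_, hx⟩
      change _ = b * (a * x) at this
      have h3 : b * (a * x) = x := by rw [← mul_assoc, hba, one_mul]
      rw [← h3, ← this]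
      exact (e.symm ⟨_, hx⟩).2
  · rintro ⟨a, ha⟩
    have h1 : (a : K) ∈ J / I := fun x hx => (ha x).mp hx
    have h2 : (↑a⁻¹ : K) ∈ I / J := fun y hy => (ha _).mpr (by rwa [Units.mul_inv_cancel_left])
    exact ⟨LinearEquiv.ofLinearMap (mulLinearMap h1) (mulLinearMap h2)
      (LinearMap.ext fun y => Subtype.ext (Units.mul_inv_cancel_left a (y : K)))
      (LinearMap.ext fun x => Subtype.ext (Units.inv_mul_cancel_left a (x : K)))⟩

omit [IsDedekindDomain Z] in
theorem nonempty_localized_linearEquiv_of_locEq {p : Ideal S} [p.IsPrime] {I J : Submodule S K}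
    (h : LocEq p I J) :
    Nonempty (LocalizedModule p.primeCompl I ≃ₗ[Localization.AtPrime p]
      LocalizedModule p.primeCompl J) := by
  obtain ⟨a, ha, b, hb, s, hs, e⟩ := h
  refine nonempty_localized_linearEquiv_of_comp_eq_smul (mulLinearMap ha) (mulLinearMap hb) hs
    (fun x => Subtype.ext ?_) fun y => Subtype.ext ?_
  · change b * (a * x) = s * x
    rw [← e]; ring
  · change a * (b * y) = s * y
    rw [← e]; ring

theorem locEq_of_localized_linearEquiv (hS : IsOrder Q S) {p : Ideal S} [p.IsPrime]
    {I J : Submodule S K} (hI : IsFracIdeal Q I) (hJ : IsFracIdeal Q J)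
    (φ : LocalizedModule p.primeCompl I ≃ₗ[Localization.AtPrime p]
      LocalizedModule p.primeCompl J) : LocEq p I J := by
  have := hS.isNoetherianRing
  have : Module.Finite S I := Module.Finite.iff_fg.mpr hI.1
  have : Module.Finite S J := Module.Finite.iff_fg.mpr hJ.1
  obtain ⟨f, g, s, hs, h⟩ := exists_comp_eq_smul_of_localized_linearEquiv φ
  obtain ⟨a, ha⟩ := exists_eq_mul_of_linearMap hS hI f
  obtain ⟨b, hb⟩ := exists_eq_mul_of_linearMap hS hJ g
  obtain ⟨d, hd, hdI⟩ := hI.exists_smul_mem 1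
  obtain ⟨u, hu, hus⟩ := h ⟨_, hdI⟩
  have hu' : (u : K) * (b * (a * (d • (1 : K)))) = u * (s * (d • (1 : K))) := by
    rw [← ha ⟨_, hdI⟩, ← hb]
    exact congrArg Subtype.val hus
  rw [Algebra.smul_def, mul_one] at hu'
  refine ⟨a, fun x hx => ha ⟨x, hx⟩ ▸ (f _).2, u * b, fun y hy => ?_, u * s,
    p.primeCompl.mul_mem hu hs, ?_⟩
  · rw [mul_assoc, ← hb ⟨y, hy⟩]
    exact I.smul_mem u (g _).2
  · refine (isUnit_algebraMap Q K hd).mul_right_cancel ?_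
    change _ = (u : K) * (s : K) * _
    linear_combination hu'

end Isomorphism

/-! ### Restriction to a suborder -/

section Restriction

variable {Z Q K : Type*} [CommRing Z] [Field Q] [Algebra Z Q] [CommRing K] [Algebra Q K]
  [Algebra Z K] [IsScalarTower Z Q K] {S T : Subalgebra Z K}

/-- A `T`-submodule of `K` regarded as a module over a smaller ring `S`. -/
def restrictTo (hST : S ≤ T) (I : Submodule T K) : Submodule S K where
  carrier := I
  zero_mem' := I.zero_mem
  add_mem' := I.add_mem
  smul_mem' s _ hx := I.smul_mem (⟨s, hST s.2⟩ : T) hx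

theorem isFracIdeal_restrictTo (hST : S ≤ T) {I : Submodule T K} (hI : IsFracIdeal Q I) :
    IsFracIdeal Q (restrictTo hST I) :=
  ⟨Submodule.FG.of_restrictScalars Z (M := K) hI.2.fg, hI.2⟩

theorem multiplicatorRing_restrictTo_eq_iff (hST : S ≤ T) (I : Submodule T K) :
    multiplicatorRing (restrictTo hST I) = T ↔ I / I = 1 := by
  have h1 : ∀ x, x ∈ (1 : Submodule T K) ↔ x ∈ T := fun x =>
    Submodule.mem_one.trans ⟨fun ⟨t, ht⟩ => ht ▸ t.2, fun hx => ⟨⟨x, hx⟩, rfl⟩⟩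
  have h2 : ∀ x, x ∈ multiplicatorRing (restrictTo hST I) ↔ x ∈ I / I := fun x => Iff.rfl
  constructor
  · intro h
    ext x
    exact ((h2 x).symm.trans (by rw [h])).trans (h1 x).symm
  · intro h
    ext x
    rw [h2, h, h1]

theorem exists_restrictTo_eq (hST : S ≤ T) {I : Submodule S K} (hI : IsFracIdeal Q I)
    (hT : multiplicatorRing I = T) :
    ∃ J : Submodule T K, IsFracIdeal Q J ∧ J / J = 1 ∧ restrictTo hST J = I := by
  subst hT
  let J : Submodule (multiplicatorRing I) K :=
    { carrier := I
      zero_mem' := I.zero_mem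
      add_mem' := I.add_mem
      smul_mem' := fun s x hx => s.2 x hx }
  have hJ : restrictTo hST J = I := rfl
  refine ⟨J, ⟨Submodule.FG.of_restrictScalars Z (M := K) hI.2.fg, hI.2⟩, ?_, rfl⟩
  rw [← multiplicatorRing_restrictTo_eq_iff hST, hJ]

end Restriction

/-! ### Multiplication by invertible ideals -/

section Invertible

variable {Z K : Type*} [CommRing Z] [CommRing K] [Algebra Z K] {T : Subalgebra Z K}

theorem isInvertible_of_mul_eq_one {L M : Submodule T K} (h : L * M = 1) : IsInvertible L := by
  refine le_antisymm Submodule.mul_one_div_le_one ?_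
  rw [← h]
  refine mul_le_mul' le_rfl ?_
  rw [Submodule.le_div_iff_mul_le, mul_comm, h]

theorem mul_div_cancel_of_isInvertible {L I : Submodule T K} (hL : IsInvertible L)
    (hI : I / I = 1) : L * I / I = L := by
  refine le_antisymm ?_ (Submodule.le_div_iff_mul_le.mpr le_rfl)
  have h : 1 / L * (L * I / I) ≤ 1 := by
    conv_rhs => rw [← hI]
    rw [Submodule.le_div_iff_mul_le, mul_assoc]
    calc 1 / L * (L * I / I * I) ≤ 1 / L * (L * I) :=
          mul_le_mul' le_rfl (Submodule.le_div_iff_mul_le.mp le_rfl)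
      _ = I := by rw [← mul_assoc, mul_comm (1 / L), hL, one_mul]
  calc L * I / I = L * (1 / L) * (L * I / I) := by rw [hL, one_mul]
    _ = L * (1 / L * (L * I / I)) := mul_assoc _ _ _
    _ ≤ L * 1 := mul_le_mul' le_rfl h
    _ = L := mul_one L

theorem locEq_mul_of_isInvertible {L I : Submodule T K} (hL : IsInvertible L)
    (P : MaximalSpectrum T) : LocEq P.asIdeal I (L * I) := by
  obtain ⟨l, hl, m, hm, h⟩ := exists_mul_notMem_of_mul_eq_one hL P.asIdeal P.isMaximal.ne_top
  refine ⟨l, fun x hx => Submodule.mul_mem_mul hl hx, m, fun y hy => ?_, h⟩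
  have h1 : 1 / L * (L * I) = I := by rw [← mul_assoc, mul_comm (1 / L), hL, one_mul]
  exact h1 ▸ Submodule.mul_mem_mul hm hy

theorem div_self_mul_of_isInvertible {L I : Submodule T K} (hL : IsInvertible L)
    (hI : I / I = 1) : L * I / (L * I) = 1 :=
  div_self_eq_one_of_locEq fun P => ⟨I, hI, locEq_mul_of_isInvertible hL P⟩

/-- If `I` and `J` are everywhere locally isomorphic then `(J : I)` is invertible and carries `I` to
`J`. -/
theorem isInvertible_div_and_div_mul_eq {I J : Submodule T K} (hI : I / I = 1)
    (h : ∀ P : MaximalSpectrum T, LocEq P.asIdeal I J) :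
    IsInvertible (J / I) ∧ J / I * I = J := by
  have h1 := (div_mul_div_eq_one_iff hI).mpr h
  refine ⟨isInvertible_of_mul_eq_one h1, le_antisymm (Submodule.le_div_iff_mul_le.mp le_rfl) ?_⟩
  calc J = J / I * (I / J) * J := by rw [h1, one_mul]
    _ = J / I * (I / J * J) := mul_assoc _ _ _
    _ ≤ J / I * I := mul_le_mul' le_rfl (Submodule.le_div_iff_mul_le.mp le_rfl)

theorem locEq_of_unit_mul {I J : Submodule T K} {a : Kˣ} (h : ∀ x : K, x ∈ I ↔ a * x ∈ J)
    (P : MaximalSpectrum T) : LocEq P.asIdeal I J :=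
  ⟨a, fun x hx => (h x).mp hx, ↑a⁻¹, fun y hy => (h _).mpr (by rwa [Units.mul_inv_cancel_left]), 1,
    fun h1 => P.isMaximal.ne_top ((Ideal.eq_top_iff_one _).mpr h1), Units.mul_inv a⟩

theorem mul_mem_mul_of_forall {L L' I : Submodule T K} {a : K} (h : ∀ x ∈ L, a * x ∈ L') {x : K}
    (hx : x ∈ L * I) : a * x ∈ L' * I := by
  induction hx using Submodule.mul_induction_on' with
  | mem_mul_mem l hl i hi =>
    rw [← mul_assoc]
    exact Submodule.mul_mem_mul (h l hl) hi
  | add y _ z _ hy hz =>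
    rw [mul_add]
    exact Submodule.add_mem _ hy hz

/-- Invertible modules may be cancelled from, and multiplied into, isomorphisms. -/
theorem unit_mul_mem_mul_iff {L L' I : Submodule T K} (hL : IsInvertible L) (hL' : IsInvertible L')
    (hI : I / I = 1) (a : Kˣ) :
    (∀ x : K, x ∈ L * I ↔ a * x ∈ L' * I) ↔ ∀ x : K, x ∈ L ↔ a * x ∈ L' := by
  constructor
  · intro h x
    conv_lhs => rw [← mul_div_cancel_of_isInvertible hL hI]
    conv_rhs => rw [← mul_div_cancel_of_isInvertible hL' hI]
    rw [Submodule.mem_div_iff_forall_mul_mem, Submodule.mem_div_iff_forall_mul_mem]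
    refine forall₂_congr fun y _ => ?_
    rw [h, mul_assoc]
  · intro h x
    refine ⟨mul_mem_mul_of_forall fun y hy => (h y).mp hy, fun hx => ?_⟩
    rw [← Units.inv_mul_cancel_left a x]
    exact mul_mem_mul_of_forall (fun y hy => (h _).mpr (by rwa [Units.mul_inv_cancel_left])) hx

end Invertible

/-! ### Weak equivalence over a suborder -/

section WeakEquivalence

variable {Z Q K : Type*} [CommRing Z] [IsDedekindDomain Z] [Field Q] [Algebra Z Q]
  [IsFractionRing Z Q] [CommRing K] [Algebra Q K] [Algebra Z K]
  [IsScalarTower Z Q K] {S T : Subalgebra Z K}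

/-- For modules over `T`, being locally isomorphic at the primes of `T` or at those of a suborder
`S` is the same: finitely many primes of `T` lie over a prime of `S`, and local generators of an
invertible `T`-module at all of them can be patched together. -/
theorem forall_locEq_restrictTo_iff (hZ : ¬ IsField Z) (hS : IsOrder Q S) (hT : IsOrder Q T)
    (hST : S ≤ T) {I J : Submodule T K} (hI : I / I = 1) :
    (∀ (p : Ideal S) [p.IsMaximal], LocEq p (restrictTo hST I) (restrictTo hST J)) ↔
      ∀ P : MaximalSpectrum T, LocEq P.asIdeal I J := by
  constructor
  · intro h P
    let ι : S →+* T := (Subalgebra.inclusion hST).toRingHom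
    have hint : ι.IsIntegral := by
      have := hT.isIntegral
      intro t
      have ht := Algebra.IsIntegral.isIntegral (R := Z) t
      exact RingHom.IsIntegralElem.of_comp (f := algebraMap Z S) (g := ι) ht
    have hp : (P.asIdeal.comap ι).IsMaximal :=
      have := P.isMaximal
      Ideal.isMaximal_comap_of_isIntegral_of_isMaximal' ι hint P.asIdeal
    obtain ⟨a, ha, b, hb, s, hs, e⟩ := h (P.asIdeal.comap ι)
    exact ⟨a, ha, b, hb, ι s, hs, e⟩
  · intro h p hp
    obtain ⟨c, hc, hcp⟩ := exists_ne_zero_algebraMap_mem hZ hS p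
    obtain ⟨a, ha, b, hb, z, hz, e⟩ :=
      exists_mul_eq_algebraMap hT ((div_mul_div_eq_one_iff hI).mpr h) hc
    refine ⟨a, ha, b, hb, algebraMap Z S z, fun hzp => hp.ne_top ?_, e⟩
    obtain ⟨w, hw⟩ := hz
    rw [Ideal.eq_top_iff_one]
    have : (1 : S) = algebraMap Z S z - algebraMap Z S c * algebraMap Z S w := by
      rw [← map_mul, ← hw, map_sub, map_one, sub_sub_cancel]
    rw [this]
    exact p.sub_mem hzp (p.mul_mem_right _ hcp)

end WeakEquivalence

/-! ### Counting classes -/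

section Count

universe u v

/-- Two quotients of `X` by the same equivalence relation have the same cardinality. -/
theorem mk_eq_mk_of_surjective {α β : Type u} {X : Type v} {p : X → α} {q : X → β}
    (hp : Function.Surjective p) (hq : Function.Surjective q)
    (h : ∀ x y, p x = p y ↔ q x = q y) : Cardinal.mk α = Cardinal.mk β := by
  refine Cardinal.mk_congr (Equiv.ofBijective (q ∘ Function.surjInv hp) ⟨fun a b hab => ?_, ?_⟩)
  · have := (h _ _).mpr hab
    rwa [Function.surjInv_eq hp, Function.surjInv_eq hp] at this
  · intro b
    obtain ⟨x, rfl⟩ := hq b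
    exact ⟨p x, (h _ _).mp (Function.surjInv_eq hp _)⟩

variable {Z Q K : Type*} [CommRing Z] [IsDedekindDomain Z] [Field Q] [Algebra Z Q]
  [IsFractionRing Z Q] [CommRing K] [Algebra Q K] [Algebra.Etale Q K] [Algebra Z K]
  [IsScalarTower Z Q K] {S T : Subalgebra Z K}

variable (Q T) in
/-- The fractional `T`-ideals with multiplicator ring `T`. -/
def ProperIdeal : Type _ := {I : Submodule T K // IsFracIdeal Q I ∧ I / I = 1}

/-- The fractional `S`-ideal underlying a fractional `T`-ideal with multiplicator ring `T`. -/
def ProperIdeal.restrict (hST : S ≤ T) (I : ProperIdeal Q T) : FracIdeal Q S :=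
  ⟨restrictTo hST I.1, isFracIdeal_restrictTo hST I.2.1⟩

/-- The primes at which `I` is not locally principal, among those where `T` has type `2`. -/
def ProperIdeal.badPrimes (I : ProperIdeal Q T) :
    Set {P : MaximalSpectrum T | typeAt Q T P = 2} :=
  {P | ¬ LocEq P.1.asIdeal 1 I.1}

theorem finite_setOf_typeAt_eq_two (hT : IsOrder Q T) :
    {P : MaximalSpectrum T | typeAt Q T P = 2}.Finite := by
  have h1 := isFracIdeal_one hT
  refine (finite_setOf_not_locEq_one hT (h1.dual hT) (h1.div hT (h1.dual hT))).subset
    fun P hP h => ?_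
  have := typeAt_le_one_of_locEq_one_dual P h
  have hP' : typeAt Q T P = 2 := hP
  omega

theorem ProperIdeal.forall_locEq_iff (hZ : ¬ IsField Z) (hT : IsOrder Q T)
    (h2 : ∀ P, typeAt Q T P ≤ 2) (I J : ProperIdeal Q T) :
    (∀ P : MaximalSpectrum T, LocEq P.asIdeal I.1 J.1) ↔ I.badPrimes = J.badPrimes := by
  constructor
  · intro h
    ext P
    have hP := P.1.isMaximal.isPrime
    exact not_congr ⟨fun h1 => h1.trans hP (h P.1), fun h1 => h1.trans hP (h P.1).symm⟩
  · intro h P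
    have hP := P.isMaximal.isPrime
    by_cases h1 : LocEq P.asIdeal (1 : Submodule T K) (dual Q 1)
    · have key : ∀ I : ProperIdeal Q T, LocEq P.asIdeal 1 I.1 := fun I =>
        (locEq_one_or_locEq_dual hZ hT I.2.1 I.2.2 P (h2 P)).elim id fun h => h1.trans hP h
      exact (key I).symm.trans hP (key J)
    · have hP2 : typeAt Q T P = 2 := by
        have := mt (locEq_one_dual_of_typeAt_le_one hZ hT P) h1
        have := h2 P
        omega
      have hiff : LocEq P.asIdeal 1 I.1 ↔ LocEq P.asIdeal 1 J.1 :=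
        not_iff_not.mp (Set.ext_iff.mp h ⟨P, hP2⟩)
      by_cases hI : LocEq P.asIdeal 1 I.1
      · exact hI.symm.trans hP (hiff.mp hI)
      · exact ((locEq_one_or_locEq_dual hZ hT I.2.1 I.2.2 P (h2 P)).resolve_left hI).symm.trans hP
          ((locEq_one_or_locEq_dual hZ hT J.2.1 J.2.2 P (h2 P)).resolve_left (mt hiff.mpr hI))

theorem ProperIdeal.badPrimes_surjective (hT : IsOrder Q T) :
    Function.Surjective (ProperIdeal.badPrimes (Q := Q) (T := T)) := by
  intro E
  have h1 := isFracIdeal_one hT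
  obtain ⟨I, hI, hE, hE'⟩ := exists_locEq_of_set hT (h1.dual hT) (h1.div hT (h1.dual hT))
    (Subtype.val '' E)
  have hII : I / I = 1 := div_self_eq_one_of_locEq fun P => by
    by_cases hP : P ∈ Subtype.val '' E
    · exact ⟨_, dual_one_div_dual_one hT, hE P hP⟩
    · exact ⟨_, one_div_one, hE' P hP⟩
  refine ⟨⟨I, hI, hII⟩, Set.ext fun P => ⟨fun h => ?_, fun hP h => ?_⟩⟩
  · by_contra hP
    refine h (hE' P.1 fun ⟨P', hP', e⟩ => hP ?_)
    rwa [← Subtype.ext e]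
  · have := typeAt_le_one_of_locEq_one_dual P.1
      (h.trans P.1.isMaximal.isPrime (hE P.1 ⟨P, hP, rfl⟩).symm)
    have h2 : typeAt Q T P.1 = 2 := P.2
    omega

omit [Algebra.Etale Q K] in
theorem ProperIdeal.weakSetoid_restrict_iff (hZ : ¬ IsField Z) (hS : IsOrder Q S)
    (hT : IsOrder Q T) (hST : S ≤ T) (I J : ProperIdeal Q T) :
    (weakSetoid Q S).r (I.restrict hST) (J.restrict hST) ↔
      ∀ P : MaximalSpectrum T, LocEq P.asIdeal I.1 J.1 := by
  rw [← forall_locEq_restrictTo_iff hZ hS hT hST I.2.2]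
  refine forall₂_congr fun p hp => ⟨fun ⟨φ⟩ => ?_, nonempty_localized_linearEquiv_of_locEq⟩
  exact locEq_of_localized_linearEquiv hS (I.restrict hST).2 (J.restrict hST).2 φ

theorem mk_weakClassesWith (hZ : ¬ IsField Z) (hS : IsOrder Q S) (hT : IsOrder Q T)
    (hST : S ≤ T) (h2 : ∀ P, typeAt Q T P ≤ 2) :
    Cardinal.mk (weakClassesWith Q S T) =
      Cardinal.mk (Set {P : MaximalSpectrum T | typeAt Q T P = 2}) := by
  refine mk_eq_mk_of_surjective (X := ProperIdeal Q T) (q := ProperIdeal.badPrimes)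
    (p := fun I => ⟨Quotient.mk _ (I.restrict hST), I.restrict hST,
      (multiplicatorRing_restrictTo_eq_iff hST _).mpr I.2.2, rfl⟩) ?_
    (ProperIdeal.badPrimes_surjective hT) fun I J => ?_
  · rintro ⟨_, I, hI, rfl⟩
    obtain ⟨J, hJ, hJJ, e⟩ := exists_restrictTo_eq hST I.2 hI
    exact ⟨⟨J, hJ, hJJ⟩, Subtype.ext (congrArg (Quotient.mk _) (Subtype.ext e))⟩
  · rw [← ProperIdeal.forall_locEq_iff hZ hT h2]
    exact (Subtype.ext_iff.trans Quotient.eq).trans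
      (ProperIdeal.weakSetoid_restrict_iff hZ hS hT hST I J)

/-- Every proper ideal is, up to isomorphism, uniquely the product of an invertible ideal and the
chosen representative of its weak equivalence class. -/
theorem mk_icmWith (hZ : ¬ IsField Z) (hS : IsOrder Q S) (hT : IsOrder Q T)
    (hST : S ≤ T) (h2 : ∀ P, typeAt Q T P ≤ 2) :
    Cardinal.mk (icmWith Q S T) =
      Cardinal.mk (Set {P : MaximalSpectrum T | typeAt Q T P = 2}) * Cardinal.mk (pic Q T) := by
  have hsurj := ProperIdeal.badPrimes_surjective (Q := Q) hT
  -- `rep E` represents the weak equivalence class of ideals not locally principal exactly on `E`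
  let rep := Function.surjInv hsurj
  have hrep : ∀ E, (rep E).badPrimes = E := Function.surjInv_eq hsurj
  let prod (x : Set {P : MaximalSpectrum T | typeAt Q T P = 2} ×
      {L : FracIdeal Q T // IsInvertible L.1}) : ProperIdeal Q T :=
    ⟨x.2.1.1 * (rep x.1).1, x.2.1.2.mul hT (rep x.1).2.1,
      div_self_mul_of_isInvertible x.2.2 (rep x.1).2.2⟩
  rw [Cardinal.mul_def]
  refine mk_eq_mk_of_surjective (X := Set {P : MaximalSpectrum T | typeAt Q T P = 2} ×
      {L : FracIdeal Q T // IsInvertible L.1})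
    (p := fun x => ⟨Quotient.mk _ ((prod x).restrict hST), (prod x).restrict hST,
      (multiplicatorRing_restrictTo_eq_iff hST _).mpr (prod x).2.2, rfl⟩)
    (q := fun x => (x.1, ⟨Quotient.mk _ x.2.1, x.2.1, x.2.2, rfl⟩)) ?_ ?_ fun x y => ?_
  · rintro ⟨_, I, hI, rfl⟩
    obtain ⟨J, hJ, hJJ, e⟩ := exists_restrictTo_eq hST I.2 hI
    let J' : ProperIdeal Q T := ⟨J, hJ, hJJ⟩
    have hloc : ∀ P : MaximalSpectrum T, LocEq P.asIdeal (rep J'.badPrimes).1 J :=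
      (ProperIdeal.forall_locEq_iff hZ hT h2 _ J').mpr (hrep _)
    obtain ⟨hinv, hmul⟩ := isInvertible_div_and_div_mul_eq (rep J'.badPrimes).2.2 hloc
    refine ⟨(J'.badPrimes, ⟨⟨_, hJ.div hT (rep J'.badPrimes).2.1⟩, hinv⟩), ?_⟩
    refine Subtype.ext (congrArg (Quotient.mk _) (Subtype.ext ?_))
    rw [← e]
    exact congrArg (restrictTo hST) hmul
  · rintro ⟨E, _, L, hL, rfl⟩
    exact ⟨(E, ⟨L, hL⟩), rfl⟩
  · have hpx : ∀ x, (prod x).badPrimes = x.1 := fun x => by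
      rw [← hrep x.1, ← ProperIdeal.forall_locEq_iff hZ hT h2]
      exact fun P => (locEq_mul_of_isInvertible x.2.2 P).symm
    refine ((Subtype.ext_iff.trans Quotient.eq).trans (nonempty_linearEquiv_iff hS
      ((prod x).restrict hST).2 ((prod y).restrict hST).2)).trans ?_
    refine Iff.trans ?_ (Prod.ext_iff.trans (and_congr Iff.rfl
      ((Subtype.ext_iff.trans Quotient.eq).trans
        (nonempty_linearEquiv_iff hT x.2.1.2 y.2.1.2)))).symm
    have hbad : ∀ a : Kˣ, (∀ z : K, z ∈ (prod x).1 ↔ a * z ∈ (prod y).1) → x.1 = y.1 :=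
      fun a h => by
        rw [← hpx x, ← hpx y, ← ProperIdeal.forall_locEq_iff hZ hT h2]
        exact locEq_of_unit_mul h
    constructor
    · rintro ⟨a, ha⟩
      have hxy := hbad a ha
      refine ⟨hxy, a, (unit_mul_mem_mul_iff x.2.2 y.2.2 (rep x.1).2.2 a).mp ?_⟩
      intro z
      have := ha z
      change z ∈ x.2.1.1 * (rep x.1).1 ↔ a * z ∈ y.2.1.1 * (rep y.1).1 at this
      rwa [← hxy] at this
    · rintro ⟨hxy, a, ha⟩
      refine ⟨a, fun z => ?_⟩
      change z ∈ x.2.1.1 * (rep x.1).1 ↔ a * z ∈ y.2.1.1 * (rep y.1).1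
      rw [← hxy]
      exact (unit_mul_mem_mul_iff x.2.2 y.2.2 (rep x.1).2.2 a).mpr ha z

end Count

end EtaleOrder

theorem corollary5p5 {Z Q K : Type*} [CommRing Z] [IsDedekindDomain Z] (hZ : ¬ IsField Z)
    [Field Q] [Algebra Z Q] [IsFractionRing Z Q]
    [CommRing K] [Nontrivial K] [Algebra Q K] [Algebra.Etale Q K]
    [Algebra Z K] [IsScalarTower Z Q K]
    (S T : Subalgebra Z K) (hS : EtaleOrder.IsOrder Q S) (hT : EtaleOrder.IsOrder Q T)
    (hST : S ≤ T) (htype : EtaleOrder.cmType Q T = 2) :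
    {p : MaximalSpectrum T | EtaleOrder.typeAt Q T p = 2}.Finite ∧
    Cardinal.mk (EtaleOrder.weakClassesWith Q S T) =
      2 ^ {p : MaximalSpectrum T | EtaleOrder.typeAt Q T p = 2}.ncard ∧
    Cardinal.mk (EtaleOrder.icmWith Q S T) =
      2 ^ {p : MaximalSpectrum T | EtaleOrder.typeAt Q T p = 2}.ncard *
        Cardinal.mk (EtaleOrder.pic Q T) := by
  have hfin := EtaleOrder.finite_setOf_typeAt_eq_two hT
  have h2 : ∀ P, EtaleOrder.typeAt Q T P ≤ 2 := fun P => by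
    have h : (EtaleOrder.typeAt Q T P : ℕ∞) ≤ EtaleOrder.cmType Q T :=
      le_iSup (fun P => (EtaleOrder.typeAt Q T P : ℕ∞)) P
    rw [htype] at h
    exact_mod_cast h
  have hcard : Cardinal.mk (Set {p : MaximalSpectrum T | EtaleOrder.typeAt Q T p = 2}) =
      2 ^ {p : MaximalSpectrum T | EtaleOrder.typeAt Q T p = 2}.ncard := by
    rw [Cardinal.mk_set, ← Set.cast_ncard hfin, Cardinal.power_natCast]
  refine ⟨hfin, ?_, ?_⟩
  · rw [EtaleOrder.mk_weakClassesWith hZ hS hT hST h2, hcard]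
  · rw [EtaleOrder.mk_icmWith hZ hS hT hST h2, hcard]
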